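/- Let $p,q\ge 2$ be integers with $(p,q)\ne(2,2)$, and let $M=S^{p-1}\times S^{q-1}$ be equipped with the pseudo-Riemannian metric $g_{S^{p-1}}\oplus(-g_{S^{q-1}})$ and the standard measure $d\omega$ (the product of the surface measures). Let $$\widetilde\Delta_M=\Delta_{S^{p-1}}-\Delta_{S^{q-1}}-\frac{p+q-4}{4(p+q-3)}\bigl((p-1)(p-2)-(q-1)(q-2)\bigr)$$ be the Yamabe operator of $M$, and $V^{p,q}=\{f\in C^\infty(M): \widetilde\Delta_M f=0\}$ (complex-valued functions). For $k\in\mathbb N=\{0,1,2,\dots\}$ let $\mathcal H^k(\mathbb R^p)=\{f\in C^\infty(S^{p-1}):\Delta_{S^{p-1}}f=-k(k+p-2)f\}$. Let $P_a$ be the orthogonal projection of $L^2(M)$ onto $\mathcal H^a(\mathbb R^p)\boxtimes L^2(S^{q-1})$, let $Q_b$ be the orthogonal projection onto $L^2(S^{p-1})\boxtimes\mathcal H^b(\mathbb R^q)$, and let $F_{a,b}$ denote the orthogonal projection of $F\in L^2(M)$ to $\mathcal H^a(\mathbb R^p)\boxtimes\mathcal H^b(\mathbb R^q)$. Define $$\operatorname{Dom}(D_p)=\Bigl\{F\in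 L^2(M):\sum_{a\in\mathbb N}\bigl(a+\tfrac{p-2}2\bigr)\|P_aF\|_{L^2(M)}^2<\infty\Bigr\},\qquad D_pF=\sum_{a\in\mathbb N}\sqrt{a+\tfrac{p-2}2}\;P_aF,$$ $$\operatorname{Dom}(D_q)=\Bigl\{F\in L^2(M):\sum_{b\in\mathbb N}\bigl(b+\tfrac{q-2}2\bigr)\|Q_bF\|_{L^2(M)}^2<\infty\Bigr\},\qquad D_qF=\sum_{b\in\mathbb N}\sqrt{b+\tfrac{q-2}2}\;Q_bF.$$ Equip $V^{p,q}$ with the inner product $(f_1,f_2)=\int_M (D_pf_1)\,\overline{D_pf_2}\,d\omega$. **Theorem.** $V^{p,q}$ has a Hilbert completion $\overline{V^{p,q}}$ with respect to this inner product. The inclusion $V^{p,q}\subset L^2(M)$ extends to a continuous injective linear map $\overline{V^{p,q}}\to L^2(M)$, and, if $\overline{V^{p,q}}$ is identified with its image, $$\overline{V^{p,q}}=\{f\in\operatorname{Dom}(D_p)\cap\operatorname{Dom}(D_q): D_pf=D_qf\}=\{f\in\operatorname{Dom}(D_p)\cap\operatorname{Dom}(D_q):\widetilde\Delta_Mf=0\},$$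 where $\widetilde\Delta_M f=0$ is meant in the sense of distributions, i.e. $\int_M f\,\widetilde\Delta_M\varphi\,d\omega=0$ for all $\varphi\in C^\infty(M)$. The norm of $\overline{V^{p,q}}$ is given by $\|F\|^2=\frac14\|(D_p+D_q)F\|_{L^2(M)}^2$. Moreover, for every $F\in\overline{V^{p,q}}$, $$F=\sum F_{a,b},\qquad D_pF=\sum\sqrt{a+\tfrac{p-2}2}\;F_{a,b},\qquad \|F\|^2=\sum\bigl(a+\tfrac{p-2}2\bigr)\|F_{a,b}\|_{L^2(M)}^2,$$ where the sums run over all $(a,b)\in\mathbb N\times\mathbb N$ with $a+\frac p2=b+\frac q2$ (and the first two converge in $L^2(M)$). -/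

import Mathlib

noncomputable section

open MeasureTheory InnerProductSpace
open scoped Manifold ContDiff

namespace MinRep

/-! ## The unit spheres and their product -/

/-- The unit sphere `S^{p-1}` in `ℝ^p`. -/
abbrev Sph (p : ℕ) : Type := Metric.sphere (0 : EuclideanSpace ℝ (Fin p)) 1

/-- The manifold `M = S^{p-1} × S^{q-1}`. -/
abbrev M (p q : ℕ) : Type := Sph p × Sph q

instance neZero_of_two_le (p : ℕ) [h : Fact (2 ≤ p)] : NeZero p :=
  ⟨by have := h.out; omega⟩

/-- The dimension count that lets Mathlib put its manifold structure on `S^{p-1}`. -/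
instance finrank_fact (p : ℕ) [NeZero p] :
    Fact (Module.finrank ℝ (EuclideanSpace ℝ (Fin p)) = (p - 1) + 1) :=
  ⟨by
    have := NeZero.ne p
    simp only [finrank_euclideanSpace, Fintype.card_fin]
    omega⟩

/-- The standard surface measure on `S^{p-1}`. -/
abbrev surf (p : ℕ) : Measure (Sph p) :=
  (volume : Measure (EuclideanSpace ℝ (Fin p))).toSphere

/-- The standard measure on `M = S^{p-1} × S^{q-1}`. -/
abbrev vol (p q : ℕ) : Measure (M p q) := (surf p).prod (surf q)

/-- The complex Hilbert space `L²(M)`. -/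
abbrev L2M (p q : ℕ) : Type := Lp ℂ 2 (vol p q)

/-- The class in `L²(M)` of a continuous function on `M`. -/
def toL2 (p q : ℕ) : C(M p q, ℂ) →L[ℂ] L2M p q :=
  ContinuousMap.toLp 2 (vol p q) ℂ

/-- `f ∈ C^∞(S^{p-1})`. -/
def SmoothSph (p : ℕ) [NeZero p] (f : Sph p → ℂ) : Prop :=
  ContMDiff (𝓡 (p - 1)) 𝓘(ℝ, ℂ) ∞ f

/-- `f ∈ C^∞(M)`. -/
def SmoothM (p q : ℕ) [NeZero p] [NeZero q] (f : M p q → ℂ) : Prop :=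
  ContMDiff ((𝓡 (p - 1)).prod (𝓡 (q - 1))) 𝓘(ℝ, ℂ) ∞ f

/-! ## The Laplace-Beltrami operators and the Yamabe operator -/

/-- The extension `z ↦ f (z / |z|)` of a function on the sphere, homogeneous of degree `0`
(with the irrelevant value `0` at the origin). -/
def radialExt {p : ℕ} (f : Sph p → ℂ) (z : EuclideanSpace ℝ (Fin p)) : ℂ :=
  if h : z ≠ 0 then f ⟨‖z‖⁻¹ • z, by simp [norm_smul, h]⟩ else 0

/-- The Laplace-Beltrami operator of the round unit sphere `S^{p-1}` (with nonpositive spectrum):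
the restriction to the sphere of the Euclidean Laplacian of the degree `0` extension. -/
def sphLaplacian {p : ℕ} (f : Sph p → ℂ) (x : Sph p) : ℂ :=
  Laplacian.laplacian (radialExt f) (x : EuclideanSpace ℝ (Fin p))

/-- `Δ_{S^{p-1}}` acting on functions on `M` in the first variable. -/
def lapFst {p q : ℕ} (f : M p q → ℂ) (z : M p q) : ℂ :=
  sphLaplacian (fun x => f (x, z.2)) z.1

/-- `Δ_{S^{q-1}}` acting on functions on `M` in the second variable. -/
def lapSnd {p q : ℕ} (f : M p q → ℂ) (z : M p q) : ℂ :=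
  sphLaplacian (fun y => f (z.1, y)) z.2

/-- The (constant) scalar curvature of `M` for the metric `g_{S^{p-1}} ⊕ (-g_{S^{q-1}})`;
the sphere `S^n` has scalar curvature `n (n - 1)`. -/
def scalarCurvature (p q : ℕ) : ℝ :=
  ((p : ℝ) - 1) * ((p : ℝ) - 2) - ((q : ℝ) - 1) * ((q : ℝ) - 2)

/-- The Yamabe operator `Δ_M - (n - 2) / (4 (n - 1)) K_M` of `M` for the metric
`g_{S^{p-1}} ⊕ (-g_{S^{q-1}})`; here `n = p + q - 2` is the dimension of `M`, and
`Δ_M = Δ_{S^{p-1}} - Δ_{S^{q-1}}`. -/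
def yamabe {p q : ℕ} (f : M p q → ℂ) (z : M p q) : ℂ :=
  (lapFst f z - lapSnd f z)
    - (((((p : ℝ) + q - 2) - 2) / (4 * (((p : ℝ) + q - 2) - 1)) * scalarCurvature p q : ℝ) : ℂ)
      * f z

/-! Smoothness of the degree `0` extension, and linearity of the operators. -/

theorem contDiffAt_radialExt {p : ℕ} [NeZero p] {f : Sph p → ℂ} (hf : SmoothSph p f)
    {z : EuclideanSpace ℝ (Fin p)} (hz : z ≠ 0) : ContDiffAt ℝ ∞ (radialExt f) z := by
  let U : TopologicalSpace.Opens (EuclideanSpace ℝ (Fin p)) := ⟨{0}ᶜ, isOpen_compl_singleton⟩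
  have hU : ∀ u : U, (u : EuclideanSpace ℝ (Fin p)) ≠ 0 := fun u => u.2
  have hn : ContMDiff 𝓘(ℝ, EuclideanSpace ℝ (Fin p)) 𝓘(ℝ, EuclideanSpace ℝ (Fin p)) ∞
      (fun u : U => ‖(u : EuclideanSpace ℝ (Fin p))‖⁻¹ • (u : EuclideanSpace ℝ (Fin p))) := by
    intro u
    refine (contMDiffAt_subtype_iff (I := 𝓘(ℝ, EuclideanSpace ℝ (Fin p)))
      (f := fun w : EuclideanSpace ℝ (Fin p) => ‖w‖⁻¹ • w)).2 ?_
    rw [contMDiffAt_iff_contDiffAt]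
    exact ((contDiffAt_norm ℝ (hU u)).inv (norm_ne_zero_iff.2 (hU u))).smul contDiffAt_id
  have hs := ContMDiff.codRestrict_sphere (n := p - 1) hn
    (fun u => by simp [norm_smul, hU u])
  have hc : ContMDiff 𝓘(ℝ, EuclideanSpace ℝ (Fin p)) 𝓘(ℝ, ℂ) ∞
      (fun u : U => radialExt f (u : EuclideanSpace ℝ (Fin p))) := by
    convert hf.comp hs using 1
    funext u
    simp only [radialExt, dif_pos (hU u), Function.comp]
    rfl
  rw [← contMDiffAt_iff_contDiffAt]
  exact (contMDiffAt_subtype_iff (U := U) (x := ⟨z, hz⟩)).1 (hc ⟨z, hz⟩)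

theorem radialExt_add {p : ℕ} (f g : Sph p → ℂ) :
    radialExt (f + g) = radialExt f + radialExt g := by
  funext z
  by_cases h : z = 0 <;> simp [radialExt, h]

theorem radialExt_smul {p : ℕ} (c : ℂ) (f : Sph p → ℂ) :
    radialExt (c • f) = c • radialExt f := by
  funext z
  by_cases h : z = 0 <;> simp [radialExt, h]

theorem sph_ne_zero {p : ℕ} (x : Sph p) : (x : EuclideanSpace ℝ (Fin p)) ≠ 0 :=
  ne_zero_of_mem_unit_sphere x

theorem two_le_infty : (2 : ℕ∞ω) ≤ ∞ := by
  exact WithTop.coe_le_coe.2 (le_top : (2 : ℕ∞) ≤ ⊤)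

theorem sphLaplacian_add {p : ℕ} [NeZero p] {f g : Sph p → ℂ} (hf : SmoothSph p f)
    (hg : SmoothSph p g) (x : Sph p) :
    sphLaplacian (f + g) x = sphLaplacian f x + sphLaplacian g x := by
  unfold sphLaplacian
  rw [radialExt_add]
  exact ((contDiffAt_radialExt hf (sph_ne_zero x)).of_le two_le_infty).laplacian_add
    ((contDiffAt_radialExt hg (sph_ne_zero x)).of_le two_le_infty)

theorem sphLaplacian_smul {p : ℕ} [NeZero p] (c : ℂ) {f : Sph p → ℂ} (hf : SmoothSph p f)
    (x : Sph p) : sphLaplacian (c • f) x = c * sphLaplacian f x := by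
  unfold sphLaplacian
  rw [radialExt_smul]
  exact laplacian_smul c
    ((contDiffAt_radialExt hf (sph_ne_zero x)).of_le two_le_infty)

theorem SmoothM.slice_fst {p q : ℕ} [NeZero p] [NeZero q] {f : M p q → ℂ}
    (hf : SmoothM p q f) (y : Sph q) : SmoothSph p (fun x => f (x, y)) :=
  ContMDiff.comp hf (contMDiff_id.prodMk contMDiff_const)

theorem SmoothM.slice_snd {p q : ℕ} [NeZero p] [NeZero q] {f : M p q → ℂ}
    (hf : SmoothM p q f) (x : Sph p) : SmoothSph q (fun y => f (x, y)) :=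
  ContMDiff.comp hf (contMDiff_const.prodMk contMDiff_id)

theorem yamabe_add {p q : ℕ} [NeZero p] [NeZero q] {f g : M p q → ℂ} (hf : SmoothM p q f)
    (hg : SmoothM p q g) (z : M p q) : yamabe (f + g) z = yamabe f z + yamabe g z := by
  have h1 := sphLaplacian_add (hf.slice_fst z.2) (hg.slice_fst z.2) z.1
  have h2 := sphLaplacian_add (hf.slice_snd z.1) (hg.slice_snd z.1) z.2
  unfold yamabe lapFst lapSnd
  change sphLaplacian ((fun x => f (x, z.2)) + fun x => g (x, z.2)) z.1
    - sphLaplacian ((fun y => f (z.1, y)) + fun y => g (z.1, y)) z.2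
    - _ * (f z + g z) = _
  rw [h1, h2]
  ring

theorem yamabe_smul {p q : ℕ} [NeZero p] [NeZero q] (c : ℂ) {f : M p q → ℂ}
    (hf : SmoothM p q f) (z : M p q) : yamabe (c • f) z = c * yamabe f z := by
  have h1 := sphLaplacian_smul c (hf.slice_fst z.2) z.1
  have h2 := sphLaplacian_smul c (hf.slice_snd z.1) z.2
  unfold yamabe lapFst lapSnd
  change sphLaplacian (c • fun x => f (x, z.2)) z.1
    - sphLaplacian (c • fun y => f (z.1, y)) z.2
    - _ * (c * f z) = _
  rw [h1, h2]
  ring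

/-! ## The space `V^{p,q}` and spherical harmonics -/

/-- `V^{p,q} = {f ∈ C^∞(M) | Δ̃_M f = 0}`. -/
def V (p q : ℕ) [NeZero p] [NeZero q] : Submodule ℂ C(M p q, ℂ) where
  carrier := {f | SmoothM p q f ∧ ∀ z, yamabe f z = 0}
  zero_mem' := by
    have h0 : SmoothM p q (0 : M p q → ℂ) := contMDiff_const
    refine ⟨h0, fun z => ?_⟩
    have := yamabe_smul 0 h0 z
    rw [zero_smul, zero_mul] at this
    exact this
  add_mem' := by
    rintro f g ⟨hf, hf'⟩ ⟨hg, hg'⟩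
    refine ⟨ContMDiff.add hf hg, fun z => ?_⟩
    rw [ContinuousMap.coe_add, yamabe_add hf hg, hf', hg', add_zero]
  smul_mem' := by
    rintro c f ⟨hf, hf'⟩
    have hc : SmoothM p q (c • (f : M p q → ℂ)) :=
      (contDiff_const_smul (𝕜 := ℝ) (F := ℂ) c).comp_contMDiff hf
    refine ⟨hc, fun z => ?_⟩
    rw [ContinuousMap.coe_smul, yamabe_smul c hf, hf', mul_zero]

/-- The space `H^k(ℝ^p)` of spherical harmonics of degree `k`:
smooth `f` on `S^{p-1}` with `Δ_{S^{p-1}} f = - k (k + p - 2) f`. -/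
def harmonics (p : ℕ) [NeZero p] (k : ℕ) : Set C(Sph p, ℂ) :=
  {f | SmoothSph p f ∧
    ∀ x, sphLaplacian f x = -((k : ℂ) * ((k : ℂ) + (p : ℂ) - 2)) * f x}

/-- `H^a(ℝ^p) ⊠ L²(S^{q-1})` as a closed subspace of `L²(M)`. -/
def compFst (p q : ℕ) [NeZero p] (a : ℕ) : Submodule ℂ (L2M p q) :=
  (Submodule.span ℂ {F : L2M p q | ∃ Y ∈ harmonics p a, ∃ g : Lp ℂ 2 (surf q),
    F =ᵐ[vol p q] fun z => Y z.1 * g z.2}).topologicalClosure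

/-- `L²(S^{p-1}) ⊠ H^b(ℝ^q)` as a closed subspace of `L²(M)`. -/
def compSnd (p q : ℕ) [NeZero q] (b : ℕ) : Submodule ℂ (L2M p q) :=
  (Submodule.span ℂ {F : L2M p q | ∃ g : Lp ℂ 2 (surf p), ∃ Z ∈ harmonics q b,
    F =ᵐ[vol p q] fun z => g z.1 * Z z.2}).topologicalClosure

/-- The `K`-type `H^a(ℝ^p) ⊠ H^b(ℝ^q)` as a closed subspace of `L²(M)`. -/
def kType (p q : ℕ) [NeZero p] [NeZero q] (a b : ℕ) : Submodule ℂ (L2M p q) :=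
  (Submodule.span ℂ {F : L2M p q | ∃ Y ∈ harmonics p a, ∃ Z ∈ harmonics q b,
    F =ᵐ[vol p q] fun z => Y z.1 * Z z.2}).topologicalClosure

instance (p q : ℕ) [NeZero p] (a : ℕ) : CompleteSpace (compFst p q a) :=
  inferInstanceAs (CompleteSpace (Submodule.topologicalClosure _))

instance (p q : ℕ) [NeZero q] (b : ℕ) : CompleteSpace (compSnd p q b) :=
  inferInstanceAs (CompleteSpace (Submodule.topologicalClosure _))

instance (p q : ℕ) [NeZero p] [NeZero q] (a b : ℕ) : CompleteSpace (kType p q a b) :=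
  inferInstanceAs (CompleteSpace (Submodule.topologicalClosure _))

/-- The component `F_{a,b}` of `F ∈ L²(M)` in `H^a(ℝ^p) ⊠ H^b(ℝ^q)` (orthogonal projection). -/
def kComp {p q : ℕ} [NeZero p] [NeZero q] (a b : ℕ) (F : L2M p q) : L2M p q :=
  (kType p q a b).starProjection F

/-! ## The operators `D_p` and `D_q` on `L²(M)` -/

/-- The eigenvalue `a + (p - 2) / 2` of `D_p²` on `H^a(ℝ^p) ⊠ L²(S^{q-1})`. -/
def eigval (p a : ℕ) : ℝ := (a : ℝ) + ((p : ℝ) - 2) / 2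

/-- The domain of `D_p`. -/
def domDp (p q : ℕ) [NeZero p] : Set (L2M p q) :=
  {F | Summable fun a : ℕ => eigval p a * ‖(compFst p q a).starProjection F‖ ^ 2}

/-- The domain of `D_q`. -/
def domDq (p q : ℕ) [NeZero q] : Set (L2M p q) :=
  {F | Summable fun b : ℕ => eigval q b * ‖(compSnd p q b).starProjection F‖ ^ 2}

/-- `D_p = (-Δ_{S^{p-1}} + (p - 2)² / 4)^{1/4}`, which acts on `H^a(ℝ^p) ⊠ L²(S^{q-1})` as the
scalar `√(a + (p - 2) / 2)`. The sum converges in `L²(M)` for `F` in the domain; the value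
outside of the domain is irrelevant. -/
def Dp {p q : ℕ} [NeZero p] (F : L2M p q) : L2M p q :=
  ∑' a : ℕ, ((Real.sqrt (eigval p a) : ℝ) : ℂ) • (compFst p q a).starProjection F

/-- `D_q = (-Δ_{S^{q-1}} + (q - 2)² / 4)^{1/4}`, which acts on `L²(S^{p-1}) ⊠ H^b(ℝ^q)` as the
scalar `√(b + (q - 2) / 2)`. -/
def Dq {p q : ℕ} [NeZero q] (F : L2M p q) : L2M p q :=
  ∑' b : ℕ, ((Real.sqrt (eigval q b) : ℝ) : ℂ) • (compSnd p q b).starProjection F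

/-- `Δ̃_M F = 0` in the sense of distributions on `M` (`Δ̃_M` is formally symmetric). -/
def WeakYamabeZero {p q : ℕ} [NeZero p] [NeZero q] (F : L2M p q) : Prop :=
  ∀ φ : M p q → ℂ, SmoothM p q φ → ∫ z, F z * yamabe φ z ∂(vol p q) = 0

/-! ## The unitary inner product and the Hilbert completion -/

/-- The inner product `(f₁, f₂) = ∫_M (D_p f₁) (conj (D_p f₂)) dω` on `V^{p,q}`
(linear in `f₁`). -/
def unitaryForm (p q : ℕ) [NeZero p] [NeZero q] (f₁ f₂ : V p q) : ℂ :=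
  ∫ z, (Dp (toL2 p q f₁) : M p q → ℂ) z
    * (starRingEnd ℂ) ((Dp (toL2 p q f₂) : M p q → ℂ) z) ∂(vol p q)

/-- `ι : W → H` exhibits the Hilbert space `H` as the Hilbert completion of the complex vector
space `W` with respect to the inner product `B` (linear in its first argument). -/
structure IsHilbertCompletion {W H : Type*} [AddCommGroup W] [Module ℂ W]
    [NormedAddCommGroup H] [InnerProductSpace ℂ H] (B : W → W → ℂ) (ι : W →ₗ[ℂ] H) : Prop where
  complete : CompleteSpace H
  dense : DenseRange ι
  inner_eq : ∀ f g : W, inner ℂ (ι g) (ι f) = B f g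

end MinRep

end

/-!
The polynomial harmonics are dense, so `L²(M)` is the Hilbert sum of the `K`-types
`ℋ^a(ℝ^p) ⊠ ℋ^b(ℝ^q)`. On such a `K`-type `D_p` and `D_q` are the scalars `√(a + (p - 2) / 2)` and
`√(b + (q - 2) / 2)`, and, since the Laplacian of the sphere is symmetric, the Yamabe operator is
the scalar `(b + (q - 2) / 2)² - (a + (p - 2) / 2)²`. Hence each of the conditions `Δ̃ F = 0` (for
smooth `F`, or weakly) and `D_p F = D_q F` says that `F` has only components with
`a + p / 2 = b + q / 2`. On those components the form of `V^{p,q}` has the weights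
`a + (p - 2) / 2`, which are at least `1 / 2` because `(p, q) ≠ (2, 2)`; so the form dominates half
the squared `L²` norm, and its completion is the part of `Dom(D_p)` supported on them.

Green's formula on the sphere is deduced from integration by parts in `ℝ^p`: extend functions to be
homogeneous of degree `0` and multiply by a radial cutoff. The gradient of the cutoff is orthogonal
to those of the extensions, so the Laplacian of the product has no cross term.
-/

noncomputable section

open MeasureTheory InnerProductSpace
open scoped Manifold ContDiff

namespace MinRep

/-! ## Hilbert sums of closed subspaces -/

section HilbertSum

variable {𝕜 E κ κ' : Type*} [RCLike 𝕜] [NormedAddCommGroup E] [InnerProductSpace 𝕜 E]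
  {K : κ → Submodule 𝕜 E} {P : κ' → Submodule 𝕜 E}

theorem starProjection_eq_of_hasSum [∀ k, (K k).HasOrthogonalProjection]
    (hK : OrthogonalFamily 𝕜 (fun k => K k) fun k => (K k).subtypeₗᵢ) {f : κ → E}
    (hf : ∀ k, f k ∈ K k) {x : E} (h : HasSum f x) (k : κ) : (K k).starProjection x = f k := by
  have h_single : HasSum (fun i => (K k).starProjection (f i)) ((K k).starProjection (f k)) :=
    hasSum_single k fun i hi =>
      (Submodule.starProjection_apply_eq_zero_iff _).2 (hK.isOrtho hi (hf i))
  rw [(h.mapL (K k).starProjection).unique h_single, Submodule.starProjection_eq_self_iff.2 (hf k)]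

variable [CompleteSpace E]

/-- The internal form of `IsHilbertSum`: `E` is the Hilbert sum of the subspaces `K k`. -/
abbrev IsInternalHilbertSum (K : κ → Submodule 𝕜 E) : Prop :=
  IsHilbertSum 𝕜 (fun k => K k) fun k => (K k).subtypeₗᵢ

section Construction

variable [∀ k, CompleteSpace (K k)]

theorem isInternalHilbertSum_of_isOrtho (hK : Pairwise fun i j => K i ⟂ K j)
    (hd : (⨆ k, K k).topologicalClosure = ⊤) : IsInternalHilbertSum K :=
  IsHilbertSum.mkInternal K (.of_pairwise hK) hd.ge

theorem IsInternalHilbertSum.topologicalClosure_iSup (hK : IsInternalHilbertSum K) :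
    (⨆ k, K k).topologicalClosure = ⊤ := by
  simpa [LinearMap.range_eq_top.2 hK.surjective_isometry] using
    hK.OrthogonalFamily.range_linearIsometry.symm

theorem IsInternalHilbertSum.of_le [∀ a, CompleteSpace (P a)] (hK : IsInternalHilbertSum K)
    (hP : Pairwise fun i j => P i ⟂ P j) {π : κ → κ'} (hKP : ∀ k, K k ≤ P (π k)) :
    IsInternalHilbertSum P :=
  isInternalHilbertSum_of_isOrtho hP <| top_le_iff.1 <| hK.topologicalClosure_iSup.ge.trans <|
    Submodule.topologicalClosure_mono <| iSup_le fun k => (hKP k).trans (le_iSup P (π k))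

end Construction

namespace IsInternalHilbertSum

variable [∀ k, (K k).HasOrthogonalProjection]

theorem hasSum_starProjection (hK : IsInternalHilbertSum K) (x : E) :
    HasSum (fun k => (K k).starProjection x) x := by
  have h := hK.hasSum_linearIsometryEquiv_symm (hK.linearIsometryEquiv x)
  rw [LinearIsometryEquiv.symm_apply_apply] at h
  convert! h using 2 with k
  exact starProjection_eq_of_hasSum hK.OrthogonalFamily (fun k => Subtype.prop _) h k

theorem ext (hK : IsInternalHilbertSum K) {x y : E}
    (h : ∀ k, (K k).starProjection x = (K k).starProjection y) : x = y :=
  (hK.hasSum_starProjection x).unique (by simpa only [h] using hK.hasSum_starProjection y)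

theorem hasSum_norm_sq_starProjection (hK : IsInternalHilbertSum K) (x : E) :
    HasSum (fun k => ‖(K k).starProjection x‖ ^ 2) (‖x‖ ^ 2) := by
  have h := RCLike.hasSum_re 𝕜 ((hK.hasSum_starProjection x).mapL (innerSL 𝕜 x))
  simpa only [innerSL_apply_apply, inner_self_eq_norm_sq, inner_re_symm (𝕜 := 𝕜) x,
    Submodule.re_inner_starProjection_eq_normSq, Submodule.coe_norm,
    Submodule.coe_orthogonalProjectionOnto_apply] using h

variable [∀ a, (P a).HasOrthogonalProjection]

/-- The graph of the diagonal operator acting on `P a` as the scalar `c a`. -/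
theorem summable_and_tsum_smul_eq_iff (hP : IsInternalHilbertSum P) {c : κ' → 𝕜} {F G : E} :
    ((Summable fun a => ‖c a • (P a).starProjection F‖ ^ 2) ∧
        ∑' a, c a • (P a).starProjection F = G) ↔
      ∀ a, (P a).starProjection G = c a • (P a).starProjection F := by
  have h_mem : ∀ a, c a • (P a).starProjection F ∈ P a := fun a =>
    (P a).smul_mem _ (Submodule.starProjection_apply_mem _ _)
  constructor
  · rintro ⟨hs, rfl⟩
    have := (hP.OrthogonalFamily.summable_iff_norm_sq_summable fun a => ⟨_, h_mem a⟩).2 hs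
    exact starProjection_eq_of_hasSum hP.OrthogonalFamily h_mem this.hasSum
  · intro h
    simp only [← h]
    exact ⟨(hP.hasSum_norm_sq_starProjection G).summable, (hP.hasSum_starProjection G).tsum_eq⟩

theorem starProjection_eq_smul_iff_of_le (hK : IsInternalHilbertSum K)
    (hP : IsInternalHilbertSum P) {π : κ → κ'} (hKP : ∀ k, K k ≤ P (π k)) {c : κ' → 𝕜} {F G : E} :
    (∀ a, (P a).starProjection G = c a • (P a).starProjection F) ↔
      ∀ k, (K k).starProjection G = c (π k) • (K k).starProjection F := by
  have h_comp (k : κ) (x : E) :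
      (K k).starProjection ((P (π k)).starProjection x) = (K k).starProjection x :=
    DFunLike.congr_fun (Submodule.starProjection_comp_starProjection_of_le (hKP k)) x
  refine ⟨fun h k => by rw [← h_comp, h, map_smul, h_comp], fun h a => hK.ext fun k => ?_⟩
  obtain rfl | ha := eq_or_ne (π k) a
  · rw [map_smul, h_comp, h_comp, h]
  · have h_zero (x : E) : (K k).starProjection ((P a).starProjection x) = 0 :=
      (Submodule.starProjection_apply_eq_zero_iff _).2 <| Submodule.orthogonal_le (hKP k) <|
        hP.OrthogonalFamily.isOrtho ha.symm (Submodule.starProjection_apply_mem _ _)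
    rw [map_smul, h_zero, h_zero, smul_zero]

theorem exists_diagonal_clm (hK : IsInternalHilbertSum K) {m : κ → 𝕜} {C : ℝ}
    (hm : ∀ k, ‖m k‖ ≤ C) :
    ∃ R : E →L[𝕜] E, ∀ k x, (K k).starProjection (R x) = m k • (K k).starProjection x := by
  have h_sq_le (x : E) (k : κ) :
      ‖m k • (K k).starProjection x‖ ^ 2 ≤ C ^ 2 * ‖(K k).starProjection x‖ ^ 2 := by
    rw [norm_smul, mul_pow]
    gcongr
    exact hm k
  have h_sum (x : E) := (hK.hasSum_norm_sq_starProjection x).mul_left (C ^ 2)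
  have hR (x : E) := hK.summable_and_tsum_smul_eq_iff.1
    ⟨.of_nonneg_of_le (fun _ => sq_nonneg _) (h_sq_le x) (h_sum x).summable, rfl⟩
  let R : E →ₗ[𝕜] E :=
    { toFun := fun x => ∑' k, m k • (K k).starProjection x
      map_add' := fun x y => hK.ext fun k => by rw [map_add, hR, hR, hR, map_add, smul_add]
      map_smul' := fun c x => hK.ext fun k => by
        rw [map_smul, hR, hR, map_smul, smul_comm, RingHom.id_apply] }
  refine ⟨R.mkContinuous |C| fun x => ?_, fun k x => hR x k⟩
  have h_norm := hasSum_le (fun k => (hR x k).symm ▸ h_sq_le x k)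
    (hK.hasSum_norm_sq_starProjection (R x)) (h_sum x)
  rw [← mul_pow, sq_le_sq, abs_norm, abs_mul, abs_norm] at h_norm
  exact h_norm

end IsInternalHilbertSum

end HilbertSum

/-! ## The Hilbert completion for the form of a diagonal operator -/

section Completion

universe u

variable {E : Type u} {W H κ : Type*} [NormedAddCommGroup E] [InnerProductSpace ℂ E]
  [CompleteSpace E] [AddCommGroup W] [Module ℂ W] [NormedAddCommGroup H] [InnerProductSpace ℂ H]
  {B : W → W → ℂ} {τ D : W →ₗ[ℂ] E} {ι : W →ₗ[ℂ] H}

theorem exists_isHilbertCompletion (hB : ∀ f g, B f g = inner ℂ (D g) (D f)) :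
    ∃ (H : Type u) (_ : NormedAddCommGroup H) (_ : InnerProductSpace ℂ H) (ι : W →ₗ[ℂ] H),
      IsHilbertCompletion B ι := by
  refine ⟨(LinearMap.range D).topologicalClosure, inferInstance, inferInstance,
    D.codRestrict _ fun f => Submodule.le_topologicalClosure _ ⟨f, rfl⟩, inferInstance, ?_,
    fun f g => (hB f g).symm⟩
  rintro ⟨x, hx⟩
  rw [closure_subtype]
  refine closure_mono ?_ hx
  rintro _ ⟨f, rfl⟩
  exact ⟨_, ⟨f, rfl⟩, rfl⟩

theorem IsHilbertCompletion.exists_linearIsometry (hι : IsHilbertCompletion B ι)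
    (hB : ∀ f g, B f g = inner ℂ (D g) (D f)) :
    ∃ T : H →ₗᵢ[ℂ] E, (∀ f, T (ι f) = D f) ∧ Set.range T = closure (Set.range D) := by
  have := hι.complete
  have h_norm (f : W) : ‖D f‖ = ‖ι f‖ := by
    rw [@norm_eq_sqrt_re_inner ℂ, @norm_eq_sqrt_re_inner ℂ, ← hB, ← hι.inner_eq]
  have hT := LinearMap.extendOfNorm_eq (f := D) hι.dense ⟨1, fun f => by rw [one_mul, h_norm]⟩
  let T : H →ₗᵢ[ℂ] E := ⟨D.extendOfNorm ι, fun h => hι.dense.induction_on h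
    (isClosed_eq (by fun_prop) (by fun_prop)) fun f => by
      rw [ContinuousLinearMap.coe_coe, hT, h_norm]⟩
  refine ⟨T, hT, ?_⟩
  have h_range : Set.range D = T '' Set.range ι := by
    rw [← Set.range_comp]
    exact congrArg Set.range (funext fun f => (hT f).symm)
  rw [h_range, T.isometry.isClosedEmbedding.closure_image_eq, hι.dense.closure_range,
    Set.image_univ]

variable {K : κ → Submodule ℂ E} [∀ k, (K k).HasOrthogonalProjection] {β : κ → ℂ} {S : Set κ}

theorem mem_closure_range_iff_of_diagonal (hK : IsInternalHilbertSum K)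
    (hD : ∀ f k, (K k).starProjection (D f) = β k • (K k).starProjection (τ f))
    (hτ : ∀ f, ∀ k ∉ S, (K k).starProjection (τ f) = 0) (hβ : ∀ k ∈ S, β k ≠ 0)
    (hd : ∀ k ∈ S, K k ≤ (LinearMap.range τ ⊓ K k).topologicalClosure) {G : E} :
    G ∈ closure (Set.range D) ↔ ∀ k ∉ S, (K k).starProjection G = 0 := by
  rw [← LinearMap.coe_range, ← Submodule.topologicalClosure_coe, SetLike.mem_coe]
  constructor
  · refine fun hG k hk => Submodule.topologicalClosure_minimal
      (t := LinearMap.ker (K k).starProjection.toLinearMap) _ ?_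
      (K k).starProjection.isClosed_ker hG
    rintro _ ⟨f, rfl⟩
    exact (hD f k).trans (by rw [hτ f k hk, smul_zero])
  · intro hG
    have h_le (k : κ) (hk : k ∈ S) : K k ≤ (LinearMap.range D).topologicalClosure := by
      refine (hd k hk).trans (Submodule.topologicalClosure_mono ?_)
      rintro _ ⟨⟨f, rfl⟩, hf⟩
      refine ⟨(β k)⁻¹ • f, hK.ext fun l => ?_⟩
      obtain rfl | hl := eq_or_ne l k
      · rw [hD, map_smul, map_smul, smul_inv_smul₀ (hβ l hk)]
      · have h_zero : (K l).starProjection (τ f) = 0 :=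
          (Submodule.starProjection_apply_eq_zero_iff _).2 (hK.OrthogonalFamily.isOrtho hl.symm hf)
        rw [hD, map_smul, map_smul, h_zero, smul_zero, smul_zero]
    refine (Submodule.isClosed_topologicalClosure _).mem_of_tendsto (hK.hasSum_starProjection G)
      (.of_forall fun s => Submodule.sum_mem _ fun k _ => ?_)
    by_cases hk : k ∈ S
    · exact h_le k hk (Submodule.starProjection_apply_mem _ _)
    · exact hG k hk ▸ Submodule.zero_mem _

theorem IsHilbertCompletion.exists_embedding_of_diagonal (hι : IsHilbertCompletion B ι)
    (hB : ∀ f g, B f g = inner ℂ (D g) (D f)) (hK : IsInternalHilbertSum K)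
    (hD : ∀ f k, (K k).starProjection (D f) = β k • (K k).starProjection (τ f))
    (hτ : ∀ f, ∀ k ∉ S, (K k).starProjection (τ f) = 0)
    (hd : ∀ k ∈ S, K k ≤ (LinearMap.range τ ⊓ K k).topologicalClosure)
    {c : ℝ} (hc : 0 < c) (hβ : ∀ k ∈ S, c ≤ ‖β k‖) :
    ∃ j : H →L[ℂ] E, (∀ f, j (ι f) = τ f) ∧ Function.Injective j ∧
      (∀ h, ∃ G, ‖G‖ = ‖h‖ ∧ ∀ k, (K k).starProjection G = β k • (K k).starProjection (j h)) ∧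
      Set.range j = {F | (∀ k ∉ S, (K k).starProjection F = 0) ∧
        ∃ G, ∀ k, (K k).starProjection G = β k • (K k).starProjection F} := by
  classical
  have hβ0 (k : κ) (hk : k ∈ S) : β k ≠ 0 := norm_pos_iff.1 (hc.trans_le (hβ k hk))
  obtain ⟨T, hTι, hT_range⟩ := hι.exists_linearIsometry hB
  have h_mem_range {G : E} : G ∈ Set.range T ↔ ∀ k ∉ S, (K k).starProjection G = 0 :=
    hT_range ▸ mem_closure_range_iff_of_diagonal hK hD hτ hβ0 hd
  obtain ⟨R, hR⟩ := hK.exists_diagonal_clm (m := fun k => if k ∈ S then (β k)⁻¹ else 0)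
    (C := c⁻¹) fun k => by
      split_ifs with hk
      · rw [norm_inv]; exact inv_anti₀ hc (hβ k hk)
      · rw [norm_zero]; exact (inv_pos.2 hc).le
  let j := R ∘L T.toContinuousLinearMap
  have h_mul {F G : E} (hF : ∀ k ∉ S, (K k).starProjection F = 0)
      (hG : ∀ k, (K k).starProjection G = β k • (K k).starProjection F) : R G = F :=
    hK.ext fun k => by
      rw [hR, hG]
      split_ifs with hk
      · rw [inv_smul_smul₀ (hβ0 k hk)]
      · rw [zero_smul, hF k hk]
  have h_supp (h : H) (k : κ) (hk : k ∉ S) : (K k).starProjection (j h) = 0 :=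
    (hR k (T h)).trans (by rw [if_neg hk, zero_smul])
  have hT (h : H) (k : κ) : (K k).starProjection (T h) = β k • (K k).starProjection (j h) := by
    by_cases hk : k ∈ S
    · refine Eq.trans ?_ (congrArg (β k • ·) (hR k (T h)).symm)
      rw [if_pos hk, smul_inv_smul₀ (hβ0 k hk)]
    · rw [h_supp h k hk, smul_zero, h_mem_range.1 ⟨h, rfl⟩ k hk]
  refine ⟨j, fun f => h_mul (hτ f) fun k => hTι f ▸ hD f k, fun h h' hh => ?_,
    fun h => ⟨T h, T.norm_map h, hT h⟩, Set.Subset.antisymm ?_ ?_⟩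
  · exact T.injective (hK.ext fun k => by rw [hT, hT, hh])
  · rintro _ ⟨h, rfl⟩
    exact ⟨h_supp h, T h, hT h⟩
  · rintro F ⟨hF, G, hG⟩
    obtain ⟨h, rfl⟩ := h_mem_range.2 fun k hk => by rw [hG, hF k hk, smul_zero]
    exact ⟨h, h_mul hF hG⟩

end Completion

/-! ## The Laplacian of products and of radial functions -/

section Laplacian

open scoped Laplacian

variable {X F ι : Type*} [NormedAddCommGroup X] [InnerProductSpace ℝ X]
  [NormedAddCommGroup F] [NormedSpace ℝ F] [Fintype ι]

theorem fderiv_comp_norm_sq_apply {φ : ℝ → F} {z : X} (hφ : DifferentiableAt ℝ φ (‖z‖ ^ 2))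
    (v : X) : fderiv ℝ (fun w => φ (‖w‖ ^ 2)) z v = (2 * inner ℝ z v) • deriv φ (‖z‖ ^ 2) := by
  have h := (hφ.hasFDerivAt.comp z (hasStrictFDerivAt_norm_sq z).hasFDerivAt).fderiv
  simpa [Function.comp_def, fderiv_eq_smul_deriv, mul_smul, ofNat_smul_eq_nsmul ℝ] using
    DFunLike.congr_fun h v

theorem differentiableAt_fderiv_apply {f : X → F} {z : X} (hf : ContDiffAt ℝ 2 f z) (v : X) :
    DifferentiableAt ℝ (fun w => fderiv ℝ f w v) z :=
  ((hf.fderiv_right (m := 1) (by norm_num)).differentiableAt (by simp)).clm_apply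
    (differentiableAt_const v)

variable [FiniteDimensional ℝ X]

theorem laplacian_eq_sum_fderiv (b : OrthonormalBasis ι ℝ X) (f : X → F) (z : X) :
    Δ f z = ∑ i, fderiv ℝ (fderiv ℝ f) z (b i) (b i) := by
  simp [laplacian_eq_iteratedFDeriv_orthonormalBasis f b, iteratedFDeriv_two_apply]

theorem laplacian_eq_sum_fderiv_fderiv (b : OrthonormalBasis ι ℝ X) {f : X → F} {z : X}
    (hf : ContDiffAt ℝ 2 f z) :
    Δ f z = ∑ i, fderiv ℝ (fun w => fderiv ℝ f w (b i)) z (b i) := by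
  rw [laplacian_eq_sum_fderiv b]
  have hf' : DifferentiableAt ℝ (fderiv ℝ f) z :=
    (hf.fderiv_right (m := 1) (by norm_num)).differentiableAt (by simp)
  refine Finset.sum_congr rfl fun i _ => ?_
  rw [fderiv_clm_apply hf' (differentiableAt_const _)]
  simp

theorem laplacian_comp_smul (f : X → F) (c : ℝ) (z : X) :
    Δ (fun w => f (c • w)) z = c ^ 2 • Δ f (c • z) := by
  have h_fderiv : fderiv ℝ (fun w => f (c • w)) = fun w => c • fderiv ℝ f (c • w) :=
    funext fun w => fderiv_comp_smul c
  have h_fderiv₂ : fderiv ℝ (fderiv ℝ fun w => f (c • w)) z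
      = c • c • fderiv ℝ (fderiv ℝ f) (c • z) := by
    rw [h_fderiv]
    refine (congrFun (fderiv_const_smul_field (𝕜 := ℝ)
      (f := fun w : X => fderiv ℝ f (c • w)) c) z).trans ?_
    rw [Pi.smul_apply, fderiv_comp_smul]
  simp only [laplacian_eq_sum_fderiv (stdOrthonormalBasis ℝ X), h_fderiv₂, smul_apply,
    Finset.smul_sum, smul_smul, sq]

theorem laplacian_fun_smul (b : OrthonormalBasis ι ℝ X) {f : X → ℝ} {g : X → F} {z : X}
    (hf : ContDiffAt ℝ 2 f z) (hg : ContDiffAt ℝ 2 g z) :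
    Δ (fun w => f w • g w) z = f z • Δ g z + Δ f z • g z
      + (2 : ℝ) • ∑ i, fderiv ℝ f z (b i) • fderiv ℝ g z (b i) := by
  have h_fderiv (i : ι) : (fun w => fderiv ℝ (fun w => f w • g w) w (b i)) =ᶠ[nhds z]
      fun w => f w • fderiv ℝ g w (b i) + fderiv ℝ f w (b i) • g w := by
    filter_upwards [hf.eventually (by simp), hg.eventually (by simp)] with w hfw hgw
    simp [fderiv_fun_smul (hfw.differentiableAt (by simp)) (hgw.differentiableAt (by simp))]
  have hf₁ := hf.differentiableAt (by simp)
  have hg₁ := hg.differentiableAt (by simp)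
  have hfg : ContDiffAt ℝ 2 (fun w => f w • g w) z := hf.smul hg
  rw [laplacian_eq_sum_fderiv_fderiv b hfg, laplacian_eq_sum_fderiv_fderiv b hf,
    laplacian_eq_sum_fderiv_fderiv b hg, Finset.smul_sum, Finset.sum_smul, Finset.smul_sum,
    ← Finset.sum_add_distrib, ← Finset.sum_add_distrib]
  refine Finset.sum_congr rfl fun i _ => ?_
  rw [(h_fderiv i).fderiv_eq, fderiv_fun_add (hf₁.fun_smul (differentiableAt_fderiv_apply hg (b i)))
    ((differentiableAt_fderiv_apply hf (b i)).fun_smul hg₁),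
    fderiv_fun_smul hf₁ (differentiableAt_fderiv_apply hg (b i)),
    fderiv_fun_smul (differentiableAt_fderiv_apply hf (b i)) hg₁]
  simp only [add_apply, smul_apply, ContinuousLinearMap.smulRight_apply]
  module

theorem laplacian_comp_norm_sq {φ : ℝ → F} {z : X} (hφ : ContDiffAt ℝ 2 φ (‖z‖ ^ 2)) :
    Δ (fun w : X => φ (‖w‖ ^ 2)) z = (4 * ‖z‖ ^ 2) • deriv (deriv φ) (‖z‖ ^ 2)
      + (2 * Module.finrank ℝ X : ℝ) • deriv φ (‖z‖ ^ 2) := by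
  let b := stdOrthonormalBasis ℝ X
  have h_norm_sq : Filter.Tendsto (fun w : X => ‖w‖ ^ 2) (nhds z) (nhds (‖z‖ ^ 2)) :=
    Continuous.tendsto (by fun_prop) z
  have hφ' : DifferentiableAt ℝ (deriv φ) (‖z‖ ^ 2) :=
    ((hφ.fderiv_right (m := 1) (by norm_num)).differentiableAt (by simp)).clm_apply
      (differentiableAt_const 1)
  have h_fderiv (v : X) : (fun w => fderiv ℝ (fun w => φ (‖w‖ ^ 2)) w v) =ᶠ[nhds z]
      fun w => (2 * inner ℝ w v) • deriv φ (‖w‖ ^ 2) := by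
    filter_upwards [h_norm_sq.eventually (hφ.eventually (by simp))] with w hw
    exact fderiv_comp_norm_sq_apply (hw.differentiableAt (by simp)) v
  have h_fderiv₂ (v : X) : fderiv ℝ (fun w => fderiv ℝ (fun w => φ (‖w‖ ^ 2)) w v) z v
      = (4 * inner ℝ z v ^ 2) • deriv (deriv φ) (‖z‖ ^ 2)
        + (2 * ‖v‖ ^ 2) • deriv φ (‖z‖ ^ 2) := by
    have h_inner : HasFDerivAt (fun w : X => 2 * inner ℝ w v) ((2 : ℝ) • innerSL ℝ v) z := by
      simpa [real_inner_comm] using ((innerSL ℝ v).hasFDerivAt (x := z)).const_mul 2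
    have h_deriv : DifferentiableAt ℝ (fun w : X => deriv φ (‖w‖ ^ 2)) z :=
      DifferentiableAt.comp (g := deriv φ) z hφ' (hasStrictFDerivAt_norm_sq z).differentiableAt
    rw [(h_fderiv v).fderiv_eq, fderiv_fun_smul h_inner.differentiableAt h_deriv, h_inner.fderiv]
    simp only [add_apply, smul_apply, fderiv_comp_norm_sq_apply hφ', smul_smul,
      ContinuousLinearMap.smulRight_apply, coe_innerSL_apply, inner_self_eq_norm_sq_to_K,
      Real.ringHom_apply, smul_eq_mul]
    ring_nf
  have hφz : ContDiffAt ℝ 2 (fun w : X => φ (‖w‖ ^ 2)) z :=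
    hφ.comp z (contDiff_norm_sq ℝ).contDiffAt
  rw [laplacian_eq_sum_fderiv_fderiv b hφz]
  simp only [h_fderiv₂, Finset.sum_add_distrib, ← Finset.sum_smul, ← Finset.mul_sum,
    b.sum_sq_inner_left, b.norm_eq_one]
  simp

theorem laplacian_comp_norm_sq_smul {φ : ℝ → ℝ} {u : X → F} {z : X}
    (hφ : ContDiffAt ℝ 2 φ (‖z‖ ^ 2)) (hu : ContDiffAt ℝ 2 u z) :
    Δ (fun w => φ (‖w‖ ^ 2) • u w) z = φ (‖z‖ ^ 2) • Δ u z + Δ (fun w : X => φ (‖w‖ ^ 2)) z • u z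
      + (4 * deriv φ (‖z‖ ^ 2)) • fderiv ℝ u z z := by
  let b := stdOrthonormalBasis ℝ X
  have h_cross : ∑ i, fderiv ℝ (fun w => φ (‖w‖ ^ 2)) z (b i) • fderiv ℝ u z (b i)
      = (2 * deriv φ (‖z‖ ^ 2)) • fderiv ℝ u z z := by
    have h_repr : fderiv ℝ u z z = ∑ i, inner ℝ z (b i) • fderiv ℝ u z (b i) := by
      conv_lhs => rw [← congrArg (fderiv ℝ u z) (b.sum_repr' z), map_sum]
      simp only [map_smul, real_inner_comm]
    rw [h_repr, Finset.smul_sum]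
    refine Finset.sum_congr rfl fun i _ => ?_
    rw [fderiv_comp_norm_sq_apply (hφ.differentiableAt (by simp)), smul_eq_mul, smul_smul]
    ring_nf
  have hφz : ContDiffAt ℝ 2 (fun w : X => φ (‖w‖ ^ 2)) z :=
    hφ.comp z (contDiff_norm_sq ℝ).contDiffAt
  rw [laplacian_fun_smul b hφz hu, h_cross, smul_smul]
  ring_nf

theorem integral_mul_laplacian_sub_of_hasCompactSupport [MeasurableSpace X] [BorelSpace X]
    {𝕜 : Type*} [RCLike 𝕜] {f g : X → 𝕜} (hf : ContDiff ℝ ∞ f) (hf' : HasCompactSupport f)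
    (hg : ContDiff ℝ ∞ g) (hg' : HasCompactSupport g) :
    ∫ z, (f z * Δ g z - Δ f z * g z) = 0 := by
  let S := hf'.toSchwartzMap hf
  let T := hg'.toSchwartzMap hg
  have h_integrable (S T : SchwartzMap X 𝕜) : Integrable fun z => S z * T z :=
    (SchwartzMap.pairing (ContinuousLinearMap.mul ℝ 𝕜) S T).integrable
  calc ∫ z, (f z * Δ g z - Δ f z * g z)
      = ∫ z, (S z * (Δ T) z - (Δ S) z * T z) := by
        simp only [SchwartzMap.laplacian_apply]
        rfl
    _ = 0 := by
        rw [integral_sub (h_integrable S (Δ T)) (h_integrable (Δ S) T),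
          SchwartzMap.integral_mul_laplacian_right_eq_left, sub_self]

end Laplacian

/-! ## Green's formula on the sphere -/

section Bump

variable {X F : Type*} [NormedAddCommGroup X] [NormedAddCommGroup F] [NormedSpace ℝ F]

/-- A smooth bump function on `ℝ` centred at `1` and vanishing near `0`, so that
`annulusBump (‖z‖ ^ 2)` is a radial cutoff supported in an annulus around the unit sphere. -/
def annulusBump : ContDiffBump (1 : ℝ) := ⟨1 / 4, 1 / 2, by norm_num, by norm_num⟩

theorem hasCompactSupport_annulusBump_smul [ProperSpace X] (u : X → F) :
    HasCompactSupport fun z => annulusBump (‖z‖ ^ 2) • u z := by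
  refine HasCompactSupport.intro (isCompact_closedBall 0 2) fun z hz => ?_
  have hz : 2 < ‖z‖ := by simpa using hz
  have h_dist : annulusBump.rOut ≤ dist (‖z‖ ^ 2) 1 := by
    rw [Real.dist_eq, abs_of_pos (by nlinarith)]
    simp only [annulusBump]
    nlinarith
  rw [annulusBump.zero_of_le_dist h_dist, zero_smul]

variable [InnerProductSpace ℝ X]

theorem contDiff_annulusBump_smul {u : X → F} (hu : ∀ z ≠ 0, ContDiffAt ℝ ∞ u z) :
    ContDiff ℝ ∞ fun z => annulusBump (‖z‖ ^ 2) • u z := by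
  rw [contDiff_iff_contDiffAt]
  intro z
  rcases eq_or_ne z 0 with rfl | hz
  · have h_near : ∀ᶠ z : X in nhds 0, ‖z‖ ^ 2 < 1 / 2 :=
      ContinuousAt.eventually_lt (by fun_prop) (by fun_prop) (by norm_num)
    refine (contDiffAt_const (c := (0 : F))).congr_of_eventuallyEq ?_
    filter_upwards [h_near] with z hz
    have h_dist : annulusBump.rOut ≤ dist (‖z‖ ^ 2) 1 := by
      rw [Real.dist_eq, abs_of_neg (by linarith)]
      simp only [annulusBump]
      linarith
    rw [annulusBump.zero_of_le_dist h_dist, zero_smul]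
  · exact (annulusBump.contDiff.comp (contDiff_norm_sq ℝ)).contDiffAt.smul (hu z hz)

/-- The radial weight `ρ(‖z‖²)² ‖z‖⁻²`, as a function of the norm, which appears when Green's
formula is applied to two functions of degree `0` cut off by `ρ = annulusBump`. -/
def annulusWeight (r : ℝ) : ℝ := annulusBump (r ^ 2) • (annulusBump (r ^ 2) • (r ^ 2)⁻¹)

theorem integral_annulusWeight_norm_pos [FiniteDimensional ℝ X] [Nontrivial X]
    [MeasurableSpace X] [BorelSpace X] : 0 < ∫ z : X, annulusWeight ‖z‖ := by
  obtain ⟨x, hx⟩ := exists_norm_eq X zero_le_one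
  have h_smooth : ∀ z : X, z ≠ 0 →
      ContDiffAt ℝ ∞ (fun z => annulusBump (‖z‖ ^ 2) • (‖z‖ ^ 2)⁻¹) z := fun z hz =>
    (annulusBump.contDiff.comp (contDiff_norm_sq ℝ)).contDiffAt.smul
      ((contDiff_norm_sq ℝ).contDiffAt.inv (by simpa using hz))
  refine Continuous.integral_pos_of_hasCompactSupport_nonneg_nonzero (x := x)
    (contDiff_annulusBump_smul h_smooth).continuous (hasCompactSupport_annulusBump_smul _)
    (fun z => ?_) ?_
  · exact mul_nonneg annulusBump.nonneg (mul_nonneg annulusBump.nonneg (by positivity))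
  · have h_one : annulusBump 1 = 1 :=
      annulusBump.one_of_mem_closedBall (by simp [annulusBump])
    simp [annulusWeight, hx, h_one]

end Bump

section Sphere

open scoped Laplacian

variable {p : ℕ}

local notation "𝔼" => EuclideanSpace ℝ (Fin p)

theorem radialExt_coe (f : Sph p → ℂ) (x : Sph p) : radialExt f (x : 𝔼) = f x := by
  rw [radialExt, dif_pos (sph_ne_zero x)]
  congr 1
  ext1
  simp

theorem radialExt_pos_smul (f : Sph p → ℂ) {c : ℝ} (hc : 0 < c) (z : 𝔼) :
    radialExt f (c • z) = radialExt f z := by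
  rcases eq_or_ne z 0 with rfl | hz
  · simp
  · rw [radialExt, radialExt, dif_pos hz, dif_pos (smul_ne_zero hc.ne' hz)]
    congr 2
    rw [norm_smul, Real.norm_of_nonneg hc.le, smul_smul]
    congr 1
    field_simp

theorem fderiv_radialExt_self [NeZero p] {f : Sph p → ℂ} (hf : SmoothSph p f) {z : 𝔼}
    (hz : z ≠ 0) : fderiv ℝ (radialExt f) z z = 0 := by
  have h_ray : HasDerivAt (fun t : ℝ => radialExt f (t • z)) (fderiv ℝ (radialExt f) z z) 1 := by
    have h_smul : HasDerivAt (fun t : ℝ => t • z) z 1 := by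
      simpa using (hasDerivAt_id (1 : ℝ)).smul_const z
    refine HasFDerivAt.comp_hasDerivAt (f := fun t : ℝ => t • z)
      (l := radialExt f) 1 ?_ h_smul
    rw [one_smul]
    exact ((contDiffAt_radialExt hf hz).differentiableAt (by simp)).hasFDerivAt
  refine h_ray.unique ((hasDerivAt_const (1 : ℝ) (radialExt f z)).congr_of_eventuallyEq ?_)
  filter_upwards [lt_mem_nhds (zero_lt_one' ℝ)] with t ht
  exact radialExt_pos_smul f ht z

theorem laplacian_radialExt (f : Sph p → ℂ) {z : 𝔼} (hz : z ≠ 0) :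
    Δ (radialExt f) z = (‖z‖ ^ 2)⁻¹ • radialExt (sphLaplacian f) z := by
  have h_pos : 0 < ‖z‖⁻¹ := inv_pos.2 (norm_pos_iff.2 hz)
  have h_scale := laplacian_comp_smul (radialExt f) ‖z‖⁻¹ z
  rw [funext (radialExt_pos_smul f h_pos), inv_pow] at h_scale
  rw [h_scale, radialExt, dif_pos hz, sphLaplacian]

theorem integral_radial_smul_radialExt [NeZero p] (k : ℝ → ℝ) (u : Sph p → ℂ) :
    ∫ z : 𝔼, k ‖z‖ • radialExt u z =
      (∫ r : Set.Ioi (0 : ℝ), k r ∂(Measure.volumeIoiPow (p - 1))) • ∫ x, u x ∂surf p := by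
  have h_polar := (volume : Measure 𝔼).measurePreserving_homeomorphUnitSphereProd.integral_comp
    (Homeomorph.measurableEmbedding _) (fun w : Sph p × Set.Ioi (0 : ℝ) => k w.2 • u w.1)
  rw [finrank_euclideanSpace_fin] at h_polar
  calc
    ∫ z : 𝔼, k ‖z‖ • radialExt u z
      = ∫ z : ({(0)}ᶜ : Set 𝔼), k ‖z.1‖ • radialExt u z.1
          ∂((volume : Measure 𝔼).comap (↑)) := by
      rw [integral_subtype_comap (measurableSet_singleton _).compl
        fun z : 𝔼 => k ‖z‖ • radialExt u z, restrict_compl_singleton]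
    _ = ∫ w, k w.2 • u w.1 ∂(surf p).prod (.volumeIoiPow (p - 1)) := by
      rw [← h_polar]
      refine integral_congr_ae (Filter.Eventually.of_forall fun z => ?_)
      have h_dir : radialExt u (z : 𝔼) = u (homeomorphUnitSphereProd 𝔼 z).1 := by
        rw [radialExt, dif_pos (show (z : 𝔼) ≠ 0 from z.2)]
        congr 1
        ext1
        simp
      simp [h_dir]
    _ = _ := by
      rw [← integral_prod_swap]
      exact integral_prod_smul (fun r : Set.Ioi (0 : ℝ) => k r) u

theorem integral_eq_zero_of_integral_annulusWeight_smul [NeZero p] {u : Sph p → ℂ}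
    (h : ∫ z : 𝔼, annulusWeight ‖z‖ • radialExt u z = 0) : ∫ x, u x ∂surf p = 0 := by
  rw [integral_radial_smul_radialExt] at h
  refine (smul_eq_zero.1 h).resolve_left fun h_zero => ?_
  have h_one : ∫ z : 𝔼, annulusWeight ‖z‖ • radialExt (fun _ => 1) z = 0 := by
    rw [integral_radial_smul_radialExt, h_zero, zero_smul]
  have h_ae : (fun z : 𝔼 => annulusWeight ‖z‖ • radialExt (fun _ => 1) z) =ᵐ[volume]
      fun z => (annulusWeight ‖z‖ : ℂ) := by
    filter_upwards [Measure.ae_ne volume (0 : 𝔼)] with z hz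
    simp [radialExt, hz]
  rw [integral_congr_ae h_ae, integral_complex_ofReal, Complex.ofReal_eq_zero] at h_one
  exact integral_annulusWeight_norm_pos.ne' h_one

theorem integral_mul_sphLaplacian_sub [NeZero p] {f g : Sph p → ℂ} (hf : SmoothSph p f)
    (hg : SmoothSph p g) :
    ∫ x, (f x * sphLaplacian g x - sphLaplacian f x * g x) ∂surf p = 0 := by
  have h_cut {u : Sph p → ℂ} (hu : SmoothSph p u) :
      ContDiff ℝ ∞ fun z : 𝔼 => annulusBump (‖z‖ ^ 2) • radialExt u z :=
    contDiff_annulusBump_smul fun z hz => contDiffAt_radialExt hu hz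
  have h_laplacian {u : Sph p → ℂ} (hu : SmoothSph p u) {z : 𝔼} (hz : z ≠ 0) :
      Δ (fun w => annulusBump (‖w‖ ^ 2) • radialExt u w) z
        = (annulusBump (‖z‖ ^ 2) • (‖z‖ ^ 2)⁻¹) • radialExt (sphLaplacian u) z
          + Δ (fun w : 𝔼 => annulusBump (‖w‖ ^ 2)) z • radialExt u z := by
    rw [laplacian_comp_norm_sq_smul annulusBump.contDiffAt
      ((contDiffAt_radialExt hu hz).of_le two_le_infty), fderiv_radialExt_self hu hz, smul_zero,
      add_zero, laplacian_radialExt u hz, smul_smul, smul_eq_mul]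
  refine integral_eq_zero_of_integral_annulusWeight_smul ?_
  rw [← integral_mul_laplacian_sub_of_hasCompactSupport (h_cut hf)
    (hasCompactSupport_annulusBump_smul _) (h_cut hg) (hasCompactSupport_annulusBump_smul _)]
  refine integral_congr_ae ?_
  filter_upwards [Measure.ae_ne volume (0 : 𝔼)] with z hz
  rw [h_laplacian hf hz, h_laplacian hg hz]
  simp only [annulusWeight, radialExt, dif_pos hz, Complex.real_smul, smul_eq_mul]
  push_cast
  ring

end Sphere

/-! ## Spherical harmonics -/

section Polynomial

open scoped Laplacian

variable {p k : ℕ}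

local notation "𝔼" => EuclideanSpace ℝ (Fin p)

/-- The function on `ℝ^p` defined by a complex polynomial in `p` variables. -/
def polyFun (P : MvPolynomial (Fin p) ℂ) (z : 𝔼) : ℂ :=
  MvPolynomial.eval (fun i => (z i : ℂ)) P

theorem contDiff_polyFun (P : MvPolynomial (Fin p) ℂ) : ContDiff ℝ ∞ (polyFun P) := by
  unfold polyFun
  simp only [MvPolynomial.eval_eq']
  exact ContDiff.sum fun d _ => contDiff_const.mul <| contDiff_prod fun i _ =>
    ((Complex.ofRealCLM.comp (EuclideanSpace.proj (𝕜 := ℝ) i)).contDiff).pow (d i)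

theorem fderiv_polyFun (P : MvPolynomial (Fin p) ℂ) (z v : 𝔼) :
    fderiv ℝ (polyFun P) z v = ∑ i, (v i : ℂ) * polyFun (MvPolynomial.pderiv i P) z := by
  have h_diff (Q : MvPolynomial (Fin p) ℂ) : DifferentiableAt ℝ (polyFun Q) z :=
    ((contDiff_polyFun Q).differentiable (by simp)) z
  induction P using MvPolynomial.induction_on with
  | C a =>
    have h_const : polyFun (p := p) (MvPolynomial.C a) = fun _ => a := by
      funext w
      simp [polyFun]
    simp [h_const, polyFun]
  | add P Q hP hQ =>
    have h_add : polyFun (P + Q) = fun w => polyFun P w + polyFun Q w := by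
      funext w
      simp [polyFun]
    rw [h_add, fderiv_fun_add (h_diff P) (h_diff Q), add_apply, hP, hQ, ← Finset.sum_add_distrib]
    simp [polyFun, mul_add]
  | mul_X P j hP =>
    have h_mul : polyFun (P * MvPolynomial.X j) = fun w => polyFun P w * (w j : ℂ) := by
      funext w
      simp [polyFun]
    have h_coord : HasFDerivAt (fun w : 𝔼 => (w j : ℂ))
        (Complex.ofRealCLM.comp (EuclideanSpace.proj (𝕜 := ℝ) j)) z :=
      (Complex.ofRealCLM.comp (EuclideanSpace.proj (𝕜 := ℝ) j)).hasFDerivAt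
    rw [h_mul, fderiv_fun_mul (h_diff P) h_coord.differentiableAt, h_coord.fderiv]
    simp only [polyFun, add_apply, smul_apply, ContinuousLinearMap.comp_apply, PiLp.proj_apply,
      Complex.ofRealCLM_apply, smul_eq_mul, hP, Finset.mul_sum, Derivation.leibniz,
      MvPolynomial.pderiv_X, Pi.single_apply, mul_ite, mul_one, mul_zero, map_add,
      apply_ite (MvPolynomial.eval _), map_zero, map_mul, MvPolynomial.eval_X, mul_add,
      Finset.sum_add_distrib, Finset.sum_ite_eq, Finset.mem_univ, ↓reduceIte]
    ring_nf

theorem polyFun_smul {P : MvPolynomial (Fin p) ℂ} (hP : P.IsHomogeneous k) (c : ℝ) (z : 𝔼) :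
    polyFun P (c • z) = (c : ℂ) ^ k * polyFun P z := by
  rw [polyFun, polyFun, MvPolynomial.eval_eq', MvPolynomial.eval_eq', Finset.mul_sum]
  refine Finset.sum_congr rfl fun d hd => ?_
  have h_degree : ∑ i, d i = k := by
    simpa [Finsupp.weight_apply, Finsupp.sum_fintype] using hP (MvPolynomial.mem_support_iff.1 hd)
  simp only [PiLp.smul_apply, smul_eq_mul, Complex.ofReal_mul, mul_pow, Finset.prod_mul_distrib,
    Finset.prod_pow_eq_pow_sum, h_degree]
  ring

theorem fderiv_polyFun_self {P : MvPolynomial (Fin p) ℂ} (hP : P.IsHomogeneous k) (z : 𝔼) :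
    fderiv ℝ (polyFun P) z z = k * polyFun P z := by
  rw [fderiv_polyFun]
  simpa [polyFun] using congrArg (fun Q => polyFun Q z) hP.sum_X_mul_pderiv

/-- The Laplacian `∑ ∂ᵢ² P` of a polynomial. -/
def polyLap (P : MvPolynomial (Fin p) ℂ) : MvPolynomial (Fin p) ℂ :=
  ∑ i, MvPolynomial.pderiv i (MvPolynomial.pderiv i P)

theorem laplacian_polyFun (P : MvPolynomial (Fin p) ℂ) (z : 𝔼) :
    Δ (polyFun P) z = polyFun (polyLap P) z := by
  have h_fderiv (Q : MvPolynomial (Fin p) ℂ) (i : Fin p) (w : 𝔼) :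
      fderiv ℝ (polyFun Q) w (EuclideanSpace.basisFun (Fin p) ℝ i)
        = polyFun (MvPolynomial.pderiv i Q) w := by
    simp [fderiv_polyFun, apply_ite Complex.ofReal]
  rw [laplacian_eq_sum_fderiv_fderiv (EuclideanSpace.basisFun (Fin p) ℝ)
    ((contDiff_polyFun P).contDiffAt.of_le two_le_infty)]
  simp only [h_fderiv]
  simp [polyFun, polyLap]

theorem isHomogeneous_polyLap {P : MvPolynomial (Fin p) ℂ} (hP : P.IsHomogeneous k) :
    (polyLap P).IsHomogeneous (k - 1 - 1) :=
  MvPolynomial.IsHomogeneous.sum _ _ _ fun _ _ => hP.pderiv.pderiv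

theorem polyLap_eq_zero {P : MvPolynomial (Fin p) ℂ} (hP : P.IsHomogeneous k) (hk : k ≤ 1) :
    polyLap P = 0 := by
  refine Finset.sum_eq_zero fun i _ => ?_
  have h_pderiv : (MvPolynomial.pderiv i P).IsHomogeneous 0 := by
    simpa [Nat.sub_eq_zero_of_le hk] using hP.pderiv (i := i)
  rw [MvPolynomial.totalDegree_eq_zero_iff_eq_C.1 (Nat.le_zero.1 h_pderiv.totalDegree_le),
    MvPolynomial.pderiv_C]

/-- The restriction to the sphere of a polynomial function. -/
def polySph (P : MvPolynomial (Fin p) ℂ) : C(Sph p, ℂ) :=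
  ⟨fun x => polyFun P x, (contDiff_polyFun P).continuous.comp continuous_subtype_val⟩

theorem smoothSph_polySph [NeZero p] (P : MvPolynomial (Fin p) ℂ) : SmoothSph p (polySph P) :=
  (contDiff_polyFun P).contMDiff.comp (contMDiff_coe_sphere (n := p - 1))

theorem radialExt_polySph {P : MvPolynomial (Fin p) ℂ} (hP : P.IsHomogeneous k) {z : 𝔼}
    (hz : z ≠ 0) : radialExt (polySph P) z = ((‖z‖ ^ 2) ^ (-k / 2 : ℝ)) • polyFun P z := by
  have h_pow : (‖z‖ ^ 2) ^ (-k / 2 : ℝ) = ‖z‖⁻¹ ^ k := by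
    rw [← Real.rpow_natCast_mul (norm_nonneg z), Nat.cast_ofNat, mul_div_cancel₀ _ two_ne_zero,
      Real.rpow_neg (norm_nonneg z), Real.rpow_natCast, inv_pow]
  rw [radialExt, dif_pos hz, h_pow, Complex.real_smul, Complex.ofReal_pow]
  exact polyFun_smul hP ‖z‖⁻¹ z

theorem sphLaplacian_polySph {P : MvPolynomial (Fin p) ℂ} (hP : P.IsHomogeneous k) (x : Sph p) :
    sphLaplacian (polySph P) x
      = polySph (polyLap P) x - (k : ℂ) * ((k : ℂ) + (p : ℂ) - 2) * polySph P x := by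
  have h_norm : ‖(x : 𝔼)‖ ^ 2 = 1 := by simp
  have h_radialExt : radialExt (polySph P) =ᶠ[nhds (x : 𝔼)]
      fun z => ((‖z‖ ^ 2) ^ (-k / 2 : ℝ)) • polyFun P z := by
    filter_upwards [isOpen_compl_singleton.mem_nhds (sph_ne_zero x)] with z hz
    exact radialExt_polySph hP hz
  have h_rpow : ContDiffAt ℝ 2 (fun t : ℝ => t ^ (-k / 2 : ℝ)) (‖(x : 𝔼)‖ ^ 2) :=
    Real.contDiffAt_rpow_const (n := 2) (Or.inl (by simp))
  rw [sphLaplacian, (laplacian_congr_nhds h_radialExt).eq_of_nhds,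
    laplacian_comp_norm_sq_smul h_rpow ((contDiff_polyFun P).contDiffAt.of_le two_le_infty),
    laplacian_comp_norm_sq h_rpow, laplacian_polyFun, fderiv_polyFun_self hP]
  simp only [h_norm, Real.deriv_rpow_const', deriv_const_mul_field, Real.one_rpow,
    finrank_euclideanSpace_fin, Complex.real_smul, smul_eq_mul, polySph, ContinuousMap.coe_mk]
  push_cast
  ring

end Polynomial

section Harmonics

variable {p : ℕ}

/-- Smooth functions on the sphere, as a subspace of the continuous functions. -/
def smoothSubmodule (p : ℕ) [NeZero p] : Submodule ℂ C(Sph p, ℂ) where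
  carrier := {f | SmoothSph p f}
  zero_mem' := contMDiff_const
  add_mem' hf hg := ContMDiff.add hf hg
  smul_mem' c _ hf := (contDiff_const_smul (𝕜 := ℝ) (F := ℂ) c).comp_contMDiff hf

/-- The Laplace-Beltrami operator as a linear map; its target is the space of all functions, so
that the smoothness of its values is not needed to define it. -/
def sphLaplacianLinear (p : ℕ) [NeZero p] : smoothSubmodule p →ₗ[ℂ] (Sph p → ℂ) where
  toFun f := sphLaplacian f.1
  map_add' f g := funext fun x => sphLaplacian_add f.2 g.2 x
  map_smul' c f := funext fun x => sphLaplacian_smul c f.2 x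

/-- The inclusion of the smooth functions into all functions on the sphere. -/
def smoothCoe (p : ℕ) [NeZero p] : smoothSubmodule p →ₗ[ℂ] (Sph p → ℂ) :=
  ContinuousMap.coeFnLinearMap ℂ ∘ₗ (smoothSubmodule p).subtype

/-- The eigenvalue `k (k + p - 2)` of `-Δ` on spherical harmonics of degree `k`. -/
def lapEigval (p k : ℕ) : ℝ := k * (k + p - 2)

theorem lapEigval_strictMono (hp : 2 ≤ p) : StrictMono (lapEigval p) := by
  intro j k hjk
  have hjk' : (j : ℝ) < k := Nat.cast_lt.2 hjk
  have hp' : (2 : ℝ) ≤ p := by exact_mod_cast hp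
  unfold lapEigval
  nlinarith [j.cast_nonneg (α := ℝ)]

theorem sphLaplacian_of_mem_harmonics [NeZero p] {k : ℕ} {f : C(Sph p, ℂ)}
    (hf : f ∈ harmonics p k) (x : Sph p) : sphLaplacian f x = -(lapEigval p k : ℂ) * f x := by
  simp [hf.2 x, lapEigval]

/-- The spherical harmonics of degree `k`, as a subspace of the smooth functions. -/
def harmonicsSubmodule (p k : ℕ) [NeZero p] : Submodule ℂ (smoothSubmodule p) :=
  LinearMap.ker (sphLaplacianLinear p - (-(lapEigval p k : ℂ)) • smoothCoe p)

theorem coe_mem_harmonics [NeZero p] {k : ℕ} {f : smoothSubmodule p}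
    (hf : f ∈ harmonicsSubmodule p k) : (f : C(Sph p, ℂ)) ∈ harmonics p k := by
  refine ⟨f.2, fun x => ?_⟩
  refine (congrFun (sub_eq_zero.1 (LinearMap.mem_ker.1 hf)) x).trans ?_
  simp [lapEigval, smoothCoe]

theorem mem_ker_sub_smul_sup_iSup_of_apply_sub_smul_eq {K V W ι : Type*} [Field K]
    [AddCommGroup V] [Module K V] [AddCommGroup W] [Module K W] {T J : V →ₗ[K] W} {l : K}
    {m : ι → K} {s : Finset ι} (hm : ∀ i ∈ s, m i ≠ l) {u w : V} (hu : T u - l • J u = J w)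
    (hw : w ∈ ⨆ i ∈ s, LinearMap.ker (T - m i • J)) :
    u ∈ LinearMap.ker (T - l • J) ⊔ ⨆ i ∈ s, LinearMap.ker (T - m i • J) := by
  obtain ⟨v, rfl⟩ := (Submodule.mem_iSup_finset_iff_exists_sum _ w).1 hw
  have hv (i : ι) : T (v i) = m i • J (v i) :=
    sub_eq_zero.1 (LinearMap.mem_ker.1 (v i).2)
  set u' : V := ∑ i ∈ s, (m i - l)⁻¹ • (v i : V) with hu'
  have h_sub : T u' - l • J u' = J (∑ i ∈ s, (v i : V)) := by
    simp only [hu', map_sum, map_smul, hv, Finset.smul_sum, ← Finset.sum_sub_distrib]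
    refine Finset.sum_congr rfl fun i hi => ?_
    rw [smul_comm l, ← smul_sub, ← sub_smul, inv_smul_smul₀ (sub_ne_zero.2 (hm i hi))]
  rw [← sub_add_cancel u u']
  refine Submodule.add_mem_sup ?_ (Submodule.sum_mem _ fun i hi =>
    Submodule.smul_mem _ _ (Submodule.mem_iSup_of_mem i (Submodule.mem_iSup_of_mem hi (v i).2)))
  rw [← h_sub, ← sub_eq_zero] at hu
  rw [LinearMap.mem_ker, ← hu]
  simp only [LinearMap.sub_apply, LinearMap.smul_apply, map_sub]

theorem polySph_mem_iSup_harmonicsSubmodule [Fact (2 ≤ p)] (k : ℕ)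
    {P : MvPolynomial (Fin p) ℂ} (hP : P.IsHomogeneous k) :
    (⟨polySph P, smoothSph_polySph P⟩ : smoothSubmodule p) ∈
      ⨆ j ∈ Finset.range (k + 1), harmonicsSubmodule p j := by
  induction k using Nat.strong_induction_on generalizing P with
  | _ k ih =>
  have h_polyLap : (⟨polySph (polyLap P), smoothSph_polySph _⟩ : smoothSubmodule p) ∈
      ⨆ j ∈ Finset.range k, harmonicsSubmodule p j := by
    rcases Nat.lt_or_ge 1 k with hk | hk
    · refine SetLike.le_def.1 (biSup_mono fun j hj => ?_)
        (ih (k - 1 - 1) (by omega) (isHomogeneous_polyLap hP))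
      rw [Finset.mem_range] at hj ⊢
      omega
    · convert Submodule.zero_mem _
      ext x
      simp [polyLap_eq_zero hP hk, polySph, polyFun]
  have hm : ∀ j ∈ Finset.range k, -(lapEigval p j : ℂ) ≠ -(lapEigval p k : ℂ) := by
    intro j hj
    rw [Ne, neg_inj, Complex.ofReal_inj]
    exact (lapEigval_strictMono Fact.out (Finset.mem_range.1 hj)).ne
  rw [Finset.range_add_one, Finset.iSup_insert]
  refine mem_ker_sub_smul_sup_iSup_of_apply_sub_smul_eq (V := smoothSubmodule p)
    (W := Sph p → ℂ) hm ?_ h_polyLap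
  funext x
  refine sub_eq_iff_eq_add.2 ((sphLaplacian_polySph hP x).trans ?_)
  simp [smoothCoe, lapEigval, sub_eq_add_neg]

end Harmonics

/-! ## Decomposition of `L²(M)` into `K`-types -/

section Density

/-- The exterior product `(x, y) ↦ Y x * Z y` on `M`, as a bilinear map in `Y` and `Z`. -/
def tensorHom (p q : ℕ) : C(Sph p, ℂ) →ₗ[ℂ] C(Sph q, ℂ) →ₗ[ℂ] C(M p q, ℂ) :=
  LinearMap.mk₂ ℂ (fun Y Z => Y.comp ContinuousMap.fst * Z.comp ContinuousMap.snd)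
    (fun _ _ _ => by ext; simp [add_mul]) (fun _ _ _ => by ext; simp [mul_assoc])
    (fun _ _ _ => by ext; simp [mul_add]) (fun _ _ _ => by ext; simp [mul_left_comm])

variable {p q : ℕ}

@[simp]
theorem tensorHom_apply (Y : C(Sph p, ℂ)) (Z : C(Sph q, ℂ)) (z : M p q) :
    tensorHom p q Y Z z = Y z.1 * Z z.2 := rfl

theorem polySph_mem_span_harmonics [Fact (2 ≤ p)] {k : ℕ} {P : MvPolynomial (Fin p) ℂ}
    (hP : P.IsHomogeneous k) : polySph P ∈ Submodule.span ℂ (⋃ a, harmonics p a) := by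
  have h_le : ⨆ j ∈ Finset.range (k + 1), harmonicsSubmodule p j ≤
      (Submodule.span ℂ (⋃ a, harmonics p a)).comap (smoothSubmodule p).subtype :=
    iSup₂_le fun j _ _ hf =>
      Submodule.subset_span (Set.mem_iUnion_of_mem j (coe_mem_harmonics hf))
  exact h_le (polySph_mem_iSup_harmonicsSubmodule k hP)

/-- The span of the exterior products of spherical harmonics. -/
def harmonicTensors (p q : ℕ) [NeZero p] [NeZero q] : Submodule ℂ C(M p q, ℂ) :=
  Submodule.map₂ (tensorHom p q) (Submodule.span ℂ (⋃ a, harmonics p a))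
    (Submodule.span ℂ (⋃ b, harmonics q b))

/-- The coordinate functions on `M ⊆ ℝ^p × ℝ^q`. -/
def coordM (p q : ℕ) : Fin p ⊕ Fin q → C(M p q, ℂ)
  | Sum.inl i => ⟨fun z => ((z.1 : EuclideanSpace ℝ (Fin p)) i : ℂ), by fun_prop⟩
  | Sum.inr i => ⟨fun z => ((z.2 : EuclideanSpace ℝ (Fin q)) i : ℂ), by fun_prop⟩

theorem star_coordM (i : Fin p ⊕ Fin q) : star (coordM p q i) = coordM p q i := by
  ext z
  cases i <;> simp [coordM]

theorem exists_coordM_ne {z w : M p q} (hzw : z ≠ w) : ∃ i, coordM p q i z ≠ coordM p q i w := by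
  contrapose! hzw
  refine Prod.ext (Subtype.ext ?_) (Subtype.ext ?_)
  · ext i
    exact Complex.ofReal_inj.1 (hzw (Sum.inl i))
  · ext i
    exact Complex.ofReal_inj.1 (hzw (Sum.inr i))

theorem aeval_coordM_monomial (s : Fin p ⊕ Fin q →₀ ℕ) (c : ℂ) :
    MvPolynomial.aeval (coordM p q) (MvPolynomial.monomial s c)
      = c • tensorHom p q
        (polySph (MvPolynomial.monomial (s.comapDomain Sum.inl Sum.inl_injective.injOn) 1))
        (polySph (MvPolynomial.monomial (s.comapDomain Sum.inr Sum.inr_injective.injOn) 1)) := by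
  ext z
  rw [MvPolynomial.aeval_monomial, Finsupp.prod_fintype _ _ (by simp)]
  simp [polySph, polyFun, MvPolynomial.eval_monomial, Finsupp.prod_fintype,
    Fintype.prod_sum_type, coordM]

theorem aeval_coordM_mem_harmonicTensors [Fact (2 ≤ p)] [Fact (2 ≤ q)]
    (P : MvPolynomial (Fin p ⊕ Fin q) ℂ) :
    MvPolynomial.aeval (coordM p q) P ∈ harmonicTensors p q := by
  induction P using MvPolynomial.induction_on' with
  | add P Q hP hQ => simpa only [map_add] using Submodule.add_mem _ hP hQ
  | monomial s c =>
    rw [aeval_coordM_monomial]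
    exact Submodule.smul_mem _ _ <| Submodule.apply_mem_map₂ _
      (polySph_mem_span_harmonics (MvPolynomial.isHomogeneous_monomial _ rfl))
      (polySph_mem_span_harmonics (MvPolynomial.isHomogeneous_monomial _ rfl))

/-- The star algebra of polynomial functions on `M`, to which Stone–Weierstrass applies. -/
def polyFunctionsM (p q : ℕ) : StarSubalgebra ℂ C(M p q, ℂ) where
  __ := (MvPolynomial.aeval (R := ℂ) (coordM p q)).range
  star_mem' := by
    rintro _ ⟨P, rfl⟩
    change star _ ∈ (MvPolynomial.aeval (R := ℂ) (coordM p q)).range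
    induction P using MvPolynomial.induction_on with
    | C a => exact ⟨MvPolynomial.C (star a), by ext; simp⟩
    | add P Q hP hQ => simpa only [map_add, star_add] using add_mem hP hQ
    | mul_X P i hP =>
      rw [map_mul, star_mul']
      exact mul_mem hP ⟨MvPolynomial.X i, by simp [star_coordM]⟩

theorem separatesPoints_polyFunctionsM : (polyFunctionsM p q).SeparatesPoints := by
  intro z w hzw
  obtain ⟨i, hi⟩ := exists_coordM_ne hzw
  exact ⟨_, ⟨coordM p q i, ⟨MvPolynomial.X i, by simp⟩, rfl⟩, hi⟩

theorem topologicalClosure_harmonicTensors (p q : ℕ) [Fact (2 ≤ p)] [Fact (2 ≤ q)] :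
    (harmonicTensors p q).topologicalClosure = ⊤ := by
  refine top_le_iff.1 fun f _ => ?_
  have hf : f ∈ (polyFunctionsM p q).topologicalClosure := by
    rw [ContinuousMap.starSubalgebra_topologicalClosure_eq_top_of_separatesPoints _
      separatesPoints_polyFunctionsM]
    trivial
  refine closure_mono ?_ hf
  rintro _ ⟨P, rfl⟩
  exact aeval_coordM_mem_harmonicTensors P

theorem toL2_coeFn (f : C(M p q, ℂ)) : toL2 p q f =ᵐ[vol p q] f :=
  ContinuousMap.coeFn_toLp (vol p q) f

theorem toL2_tensorHom_mem_kType [NeZero p] [NeZero q] {a b : ℕ} {Y : C(Sph p, ℂ)}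
    {Z : C(Sph q, ℂ)} (hY : Y ∈ harmonics p a) (hZ : Z ∈ harmonics q b) :
    toL2 p q (tensorHom p q Y Z) ∈ kType p q a b :=
  Submodule.le_topologicalClosure _ (Submodule.subset_span ⟨Y, hY, Z, hZ, toL2_coeFn _⟩)

theorem topologicalClosure_iSup_kType (p q : ℕ) [Fact (2 ≤ p)] [Fact (2 ≤ q)] :
    (⨆ k : ℕ × ℕ, kType p q k.1 k.2).topologicalClosure = ⊤ := by
  have h_dense : ((harmonicTensors p q).map
      (toL2 p q : C(M p q, ℂ) →ₗ[ℂ] L2M p q)).topologicalClosure = ⊤ :=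
    (ContinuousMap.toLp_denseRange ℂ (vol p q) ℂ (p := 2)
      (by simp)).topologicalClosure_map_submodule (topologicalClosure_harmonicTensors p q)
  refine top_le_iff.1 (h_dense.ge.trans (Submodule.topologicalClosure_mono ?_))
  rw [Submodule.map_le_iff_le_comap, harmonicTensors, Submodule.map₂_span_span, Submodule.span_le]
  rintro _ ⟨Y, hY, Z, hZ, rfl⟩
  obtain ⟨a, hY⟩ := Set.mem_iUnion.1 hY
  obtain ⟨b, hZ⟩ := Set.mem_iUnion.1 hZ
  exact Submodule.mem_iSup_of_mem (a, b) (toL2_tensorHom_mem_kType hY hZ)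

end Density

section InnerProduct

variable {𝕜 E X Y : Type*} [RCLike 𝕜]

theorem mem_orthogonal_topologicalClosure_span_iff [NormedAddCommGroup E] [InnerProductSpace 𝕜 E]
    {s : Set E} {x : E} :
    x ∈ (Submodule.span 𝕜 s).topologicalClosureᗮ ↔ ∀ y ∈ s, inner 𝕜 y x = 0 := by
  rw [Submodule.orthogonal_closure]
  simp only [← Submodule.mem_orthogonal_singleton_iff_inner_left]
  rw [← Submodule.span_singleton_le_iff_mem, ← Submodule.isOrtho_iff_le, Submodule.isOrtho_comm,
    Submodule.isOrtho_iff_le, Submodule.span_le]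
  rfl

theorem isOrtho_topologicalClosure_span [NormedAddCommGroup E] [InnerProductSpace 𝕜 E]
    {s t : Set E} (h : ∀ x ∈ s, ∀ y ∈ t, inner 𝕜 x y = 0) :
    (Submodule.span 𝕜 s).topologicalClosure ⟂ (Submodule.span 𝕜 t).topologicalClosure := by
  rw [Submodule.isOrtho_iff_le, Submodule.orthogonal_closure]
  exact Submodule.topologicalClosure_minimal _ (Submodule.isOrtho_span.2 fun x hx y => h x hx y)
    (Submodule.isClosed_orthogonal _)

theorem inner_eq_integral_mul_integral [MeasurableSpace X] [MeasurableSpace Y] {μ : Measure X}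
    {ν : Measure Y} [SFinite μ] [SFinite ν] {F F' : Lp 𝕜 2 (μ.prod ν)} {f f' : X → 𝕜} {g g' : Y → 𝕜}
    (hF : F =ᵐ[μ.prod ν] fun z => f z.1 * g z.2)
    (hF' : F' =ᵐ[μ.prod ν] fun z => f' z.1 * g' z.2) :
    inner 𝕜 F F' = (∫ x, inner 𝕜 (f x) (f' x) ∂μ) * ∫ y, inner 𝕜 (g y) (g' y) ∂ν := by
  rw [L2.inner_def, ← integral_prod_mul]
  refine integral_congr_ae ?_
  filter_upwards [hF, hF'] with z hz hz'
  simp only [hz, hz', RCLike.inner_apply, map_mul]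
  ring

end InnerProduct

section Orthogonality

variable {p q : ℕ}

theorem sphLaplacian_star [NeZero p] {f : Sph p → ℂ} (hf : SmoothSph p f) (x : Sph p) :
    sphLaplacian (star f) x = star (sphLaplacian f x) := by
  have h_star : radialExt (star f) = Complex.conjCLE.toContinuousLinearMap ∘ radialExt f := by
    funext z
    by_cases h : z = 0 <;> simp [radialExt, h]
  rw [sphLaplacian, h_star,
    ((contDiffAt_radialExt hf (sph_ne_zero x)).of_le two_le_infty).laplacian_CLM_comp_left]
  rfl

theorem SmoothSph.star [NeZero p] {f : Sph p → ℂ} (hf : SmoothSph p f) : SmoothSph p (star f) :=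
  Complex.conjCLE.toContinuousLinearMap.contDiff.comp_contMDiff hf

theorem star_mem_harmonics [NeZero p] {k : ℕ} {f : C(Sph p, ℂ)} (hf : f ∈ harmonics p k) :
    star f ∈ harmonics p k := by
  refine ⟨hf.1.star, fun x => ?_⟩
  rw [ContinuousMap.coe_star, sphLaplacian_star hf.1, hf.2]
  simp

theorem integral_mul_eq_zero_of_mem_harmonics [Fact (2 ≤ p)] {j k : ℕ} (hjk : j ≠ k)
    {f g : C(Sph p, ℂ)} (hf : f ∈ harmonics p j) (hg : g ∈ harmonics p k) :
    ∫ x, f x * g x ∂surf p = 0 := by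
  have h_green := integral_mul_sphLaplacian_sub hf.1 hg.1
  have h_sub (x : Sph p) : f x * sphLaplacian g x - sphLaplacian f x * g x
      = ((lapEigval p j - lapEigval p k : ℝ) : ℂ) * (f x * g x) := by
    rw [sphLaplacian_of_mem_harmonics hf, sphLaplacian_of_mem_harmonics hg]
    push_cast
    ring
  simp only [h_sub, integral_const_mul] at h_green
  refine (mul_eq_zero.1 h_green).resolve_left (Complex.ofReal_ne_zero.2 (sub_ne_zero.2 ?_))
  exact (lapEigval_strictMono Fact.out).injective.ne hjk

theorem integral_inner_eq_zero_of_mem_harmonics [Fact (2 ≤ p)] {j k : ℕ} (hjk : j ≠ k)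
    {f g : C(Sph p, ℂ)} (hf : f ∈ harmonics p j) (hg : g ∈ harmonics p k) :
    ∫ x, inner ℂ (f x) (g x) ∂surf p = 0 := by
  simpa [mul_comm] using integral_mul_eq_zero_of_mem_harmonics hjk (star_mem_harmonics hf) hg

theorem pairwise_isOrtho_compFst (p q : ℕ) [Fact (2 ≤ p)] :
    Pairwise fun a a' => compFst p q a ⟂ compFst p q a' := by
  intro a a' haa'
  refine isOrtho_topologicalClosure_span ?_
  rintro F ⟨Y, hY, g, hF⟩ F' ⟨Y', hY', g', hF'⟩
  rw [inner_eq_integral_mul_integral hF hF',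
    integral_inner_eq_zero_of_mem_harmonics haa' hY hY', zero_mul]

theorem pairwise_isOrtho_compSnd (p q : ℕ) [Fact (2 ≤ q)] :
    Pairwise fun b b' => compSnd p q b ⟂ compSnd p q b' := by
  intro b b' hbb'
  refine isOrtho_topologicalClosure_span ?_
  rintro F ⟨g, Z, hZ, hF⟩ F' ⟨g', Z', hZ', hF'⟩
  rw [inner_eq_integral_mul_integral hF hF',
    integral_inner_eq_zero_of_mem_harmonics hbb' hZ hZ', mul_zero]

theorem kType_le_compFst (p q : ℕ) [NeZero p] [NeZero q] (k : ℕ × ℕ) :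
    kType p q k.1 k.2 ≤ compFst p q k.1 := by
  refine Submodule.topologicalClosure_mono (Submodule.span_mono ?_)
  rintro F ⟨Y, hY, Z, _, hF⟩
  refine ⟨Y, hY, ContinuousMap.toLp 2 (surf q) ℂ Z, hF.trans ?_⟩
  filter_upwards [Measure.quasiMeasurePreserving_snd.ae
    (ContinuousMap.coeFn_toLp (p := 2) (𝕜 := ℂ) (surf q) Z)] with z hz
  rw [hz]

theorem kType_le_compSnd (p q : ℕ) [NeZero p] [NeZero q] (k : ℕ × ℕ) :
    kType p q k.1 k.2 ≤ compSnd p q k.2 := by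
  refine Submodule.topologicalClosure_mono (Submodule.span_mono ?_)
  rintro F ⟨Y, _, Z, hZ, hF⟩
  refine ⟨ContinuousMap.toLp 2 (surf p) ℂ Y, Z, hZ, hF.trans ?_⟩
  filter_upwards [Measure.quasiMeasurePreserving_fst.ae
    (ContinuousMap.coeFn_toLp (p := 2) (𝕜 := ℂ) (surf p) Y)] with z hz
  rw [hz]

theorem pairwise_isOrtho_kType (p q : ℕ) [Fact (2 ≤ p)] [Fact (2 ≤ q)] :
    Pairwise fun k l : ℕ × ℕ => kType p q k.1 k.2 ⟂ kType p q l.1 l.2 := by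
  intro k l hkl
  by_cases h_fst : k.1 = l.1
  · exact (pairwise_isOrtho_compSnd p q fun h_snd => hkl (Prod.ext h_fst h_snd)).mono
      (kType_le_compSnd p q k) (kType_le_compSnd p q l)
  · exact (pairwise_isOrtho_compFst p q h_fst).mono
      (kType_le_compFst p q k) (kType_le_compFst p q l)

theorem isInternalHilbertSum_kType (p q : ℕ) [Fact (2 ≤ p)] [Fact (2 ≤ q)] :
    IsInternalHilbertSum fun k : ℕ × ℕ => kType p q k.1 k.2 :=
  isInternalHilbertSum_of_isOrtho (pairwise_isOrtho_kType p q) (topologicalClosure_iSup_kType p q)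

theorem isInternalHilbertSum_compFst (p q : ℕ) [Fact (2 ≤ p)] [Fact (2 ≤ q)] :
    IsInternalHilbertSum (compFst p q) :=
  (isInternalHilbertSum_kType p q).of_le (pairwise_isOrtho_compFst p q) (kType_le_compFst p q)

theorem isInternalHilbertSum_compSnd (p q : ℕ) [Fact (2 ≤ p)] [Fact (2 ≤ q)] :
    IsInternalHilbertSum (compSnd p q) :=
  (isInternalHilbertSum_kType p q).of_le (pairwise_isOrtho_compSnd p q) (kType_le_compSnd p q)

theorem inner_toL2 (f : C(M p q, ℂ)) (F : L2M p q) :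
    inner ℂ (toL2 p q f) F = ∫ z, F z * star f z ∂vol p q := by
  rw [L2.inner_def]
  refine integral_congr_ae ?_
  filter_upwards [toL2_coeFn f] with z hz
  simp [hz]

theorem star_tensorHom (Y : C(Sph p, ℂ)) (Z : C(Sph q, ℂ)) :
    star (tensorHom p q Y Z) = tensorHom p q (star Y) (star Z) := by
  ext z
  simp

theorem kComp_eq_smul_of_integral_eq [NeZero p] [NeZero q] {a b : ℕ} {F G : L2M p q} {c : ℂ}
    (h : ∀ Y ∈ harmonics p a, ∀ Z ∈ harmonics q b,
      ∫ z, G z * tensorHom p q Y Z z ∂vol p q = c * ∫ z, F z * tensorHom p q Y Z z ∂vol p q) :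
    kComp a b G = c • kComp a b F := by
  rw [← sub_eq_zero, kComp, kComp, ← map_smul, ← map_sub,
    Submodule.starProjection_apply_eq_zero_iff]
  refine mem_orthogonal_topologicalClosure_span_iff.2 ?_
  rintro F' ⟨Y, hY, Z, hZ, hF'⟩
  obtain rfl : F' = toL2 p q (tensorHom p q Y Z) :=
    Lp.ext (hF'.trans (toL2_coeFn (tensorHom p q Y Z)).symm)
  rw [inner_sub_right, inner_smul_right, inner_toL2, inner_toL2, star_tensorHom,
    h _ (star_mem_harmonics hY) _ (star_mem_harmonics hZ), sub_self]

end Orthogonality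

/-! ## The Yamabe operator on smooth functions -/

section BiradialExtension

open scoped Laplacian

theorem laplacian_slice {X Y F ι : Type*} [NormedAddCommGroup X] [InnerProductSpace ℝ X]
    [FiniteDimensional ℝ X] [NormedAddCommGroup Y] [NormedSpace ℝ Y] [NormedAddCommGroup F]
    [NormedSpace ℝ F] [Fintype ι] (b : OrthonormalBasis ι ℝ X) {f : X × Y → F} {z : X × Y}
    (hf : ContDiffAt ℝ 2 f z) :
    Δ (fun x => f (x, z.2)) z.1 = ∑ i, fderiv ℝ (fderiv ℝ f) z (b i, 0) (b i, 0) := by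
  have h_slice (x : X) : HasFDerivAt (fun x => (x, z.2)) (ContinuousLinearMap.inl ℝ X Y) x :=
    hasFDerivAt_prodMk_left x z.2
  have h_contDiffAt : ContDiffAt ℝ 2 (fun x => f (x, z.2)) z.1 :=
    hf.comp z.1 (contDiffAt_id.prodMk contDiffAt_const)
  have h_fderiv (i : ι) : (fun x => fderiv ℝ (fun x => f (x, z.2)) x (b i)) =ᶠ[nhds z.1]
      fun x => fderiv ℝ f (x, z.2) (b i, 0) := by
    filter_upwards [(h_slice z.1).continuousAt.eventually (hf.eventually (by simp))] with x hx
    have h_comp : HasFDerivAt (fun x => f (x, z.2)) _ x :=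
      (hx.differentiableAt (by simp)).hasFDerivAt.comp x (h_slice x)
    simp [h_comp.fderiv]
  have hf' : HasFDerivAt (fderiv ℝ f) (fderiv ℝ (fderiv ℝ f) z) (z.1, z.2) :=
    ((hf.fderiv_right (m := 1) (by norm_num)).differentiableAt (by simp)).hasFDerivAt
  rw [laplacian_eq_sum_fderiv_fderiv b h_contDiffAt]
  refine Finset.sum_congr rfl fun i _ => ?_
  rw [(h_fderiv i).fderiv_eq,
    ((hf'.comp z.1 (h_slice z.1)).clm_apply (hasFDerivAt_const (b i, (0 : Y)) z.1)).fderiv]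
  simp

theorem contMDiff_normalize {X : Type*} [NormedAddCommGroup X] [NormedSpace ℝ X] {p : ℕ} [NeZero p]
    {U : TopologicalSpace.Opens X} {g : X → EuclideanSpace ℝ (Fin p)}
    (hg : ∀ u ∈ U, ContDiffAt ℝ ∞ g u) (h0 : ∀ u ∈ U, g u ≠ 0) :
    ContMDiff 𝓘(ℝ, X) (𝓡 (p - 1)) ∞
      fun u : U => (⟨‖g u‖⁻¹ • g u, by simp [norm_smul, h0 u u.2]⟩ : Sph p) := by
  refine ContMDiff.codRestrict_sphere (n := p - 1) (fun u => ?_) _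
  refine (contMDiffAt_subtype_iff (f := fun w => ‖g w‖⁻¹ • g w)).2 ?_
  rw [contMDiffAt_iff_contDiffAt]
  exact (((hg u u.2).norm ℝ (h0 u u.2)).inv (norm_ne_zero_iff.2 (h0 u u.2))).smul (hg u u.2)

variable {p q : ℕ}

/-- The extension of a function on `M` to `ℝ^p × ℝ^q`, homogeneous of degree `0` in each
variable; all derivatives along `M` are derivatives of this extension. -/
def biradialExt (f : M p q → ℂ) (w : EuclideanSpace ℝ (Fin p) × EuclideanSpace ℝ (Fin q)) : ℂ :=
  radialExt (fun x => radialExt (fun y => f (x, y)) w.2) w.1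

variable [NeZero p] [NeZero q] {f : M p q → ℂ}

theorem contDiffAt_biradialExt (hf : SmoothM p q f)
    {w : EuclideanSpace ℝ (Fin p) × EuclideanSpace ℝ (Fin q)} (h₁ : w.1 ≠ 0) (h₂ : w.2 ≠ 0) :
    ContDiffAt ℝ ∞ (biradialExt f) w := by
  let U : TopologicalSpace.Opens (EuclideanSpace ℝ (Fin p) × EuclideanSpace ℝ (Fin q)) :=
    ⟨{0}ᶜ ×ˢ {0}ᶜ, isOpen_compl_singleton.prod isOpen_compl_singleton⟩
  have h_smooth : ContMDiff 𝓘(ℝ, EuclideanSpace ℝ (Fin p) × EuclideanSpace ℝ (Fin q)) 𝓘(ℝ, ℂ) ∞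
      fun u : U => biradialExt f u := by
    convert ContMDiff.comp hf
      ((contMDiff_normalize (U := U) (fun _ _ => contDiffAt_fst) fun _ hu => hu.1).prodMk
        (contMDiff_normalize (U := U) (fun _ _ => contDiffAt_snd) fun _ hu => hu.2)) using 1
    funext u
    have hu₁ : u.1.1 ≠ 0 := u.2.1
    have hu₂ : u.1.2 ≠ 0 := u.2.2
    simp only [biradialExt, radialExt, dif_pos hu₁, dif_pos hu₂, Function.comp]
  rw [← contMDiffAt_iff_contDiffAt]
  exact (contMDiffAt_subtype_iff (U := U) (x := ⟨w, h₁, h₂⟩)).1 (h_smooth ⟨w, h₁, h₂⟩)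

theorem lapFst_eq_sum_fderiv (hf : SmoothM p q f) (z : M p q) :
    lapFst f z = ∑ i, fderiv ℝ (fderiv ℝ (biradialExt f)) (Prod.map (↑) (↑) z)
      (EuclideanSpace.basisFun (Fin p) ℝ i, 0) (EuclideanSpace.basisFun (Fin p) ℝ i, 0) := by
  rw [← laplacian_slice (EuclideanSpace.basisFun (Fin p) ℝ)
    ((contDiffAt_biradialExt hf (sph_ne_zero z.1) (sph_ne_zero z.2)).of_le two_le_infty), lapFst,
    sphLaplacian]
  simp only [biradialExt, Prod.map_fst, Prod.map_snd, radialExt_coe]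

theorem SmoothM.continuous_lapFst (hf : SmoothM p q f) : Continuous (lapFst f) := by
  rw [funext (lapFst_eq_sum_fderiv hf)]
  refine continuous_finsetSum _ fun i _ => continuous_iff_continuousAt.2 fun z => ?_
  have h_fderiv : ContDiffAt ℝ ∞ (fderiv ℝ (fderiv ℝ (biradialExt f))) (Prod.map (↑) (↑) z) :=
    ((contDiffAt_biradialExt hf (sph_ne_zero z.1) (sph_ne_zero z.2)).fderiv_right (m := ∞)
      (by simp)).fderiv_right (by simp)
  have h_coe : ContinuousAt (Prod.map (↑) (↑) :
      M p q → EuclideanSpace ℝ (Fin p) × EuclideanSpace ℝ (Fin q)) z := by fun_prop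
  exact ((h_fderiv.continuousAt.comp h_coe).clm_apply continuousAt_const).clm_apply
    continuousAt_const

theorem SmoothM.swap (hf : SmoothM p q f) : SmoothM q p (f ∘ Prod.swap) :=
  ContMDiff.comp hf (contMDiff_snd.prodMk contMDiff_fst)

theorem SmoothM.continuous_lapSnd (hf : SmoothM p q f) : Continuous (lapSnd f) :=
  show Continuous (lapFst (f ∘ Prod.swap) ∘ Prod.swap) from
    hf.swap.continuous_lapFst.comp continuous_swap

theorem SmoothM.continuous (hf : SmoothM p q f) : Continuous f :=
  ContMDiff.continuous hf

theorem SmoothM.continuous_yamabe (hf : SmoothM p q f) : Continuous (yamabe f) :=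
  (hf.continuous_lapFst.sub hf.continuous_lapSnd).sub (continuous_const.mul hf.continuous)

end BiradialExtension

section Green

variable {p q : ℕ}

theorem integrable_vol {f : M p q → ℂ} (hf : Continuous f) : Integrable f (vol p q) :=
  hf.integrable_of_hasCompactSupport (HasCompactSupport.of_compactSpace f)

variable [NeZero p] [NeZero q] {f g : M p q → ℂ}

theorem integrable_mul_lapFst_sub (hf : SmoothM p q f) (hg : SmoothM p q g) :
    Integrable (fun z => f z * lapFst g z - lapFst f z * g z) (vol p q) :=
  integrable_vol ((hf.continuous.mul hg.continuous_lapFst).sub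
    (hf.continuous_lapFst.mul hg.continuous))

theorem integrable_mul_lapSnd_sub (hf : SmoothM p q f) (hg : SmoothM p q g) :
    Integrable (fun z => f z * lapSnd g z - lapSnd f z * g z) (vol p q) :=
  integrable_vol ((hf.continuous.mul hg.continuous_lapSnd).sub
    (hf.continuous_lapSnd.mul hg.continuous))

theorem integral_mul_lapFst_sub (hf : SmoothM p q f) (hg : SmoothM p q g) :
    ∫ z, (f z * lapFst g z - lapFst f z * g z) ∂vol p q = 0 := by
  refine (integral_prod_symm _ (integrable_mul_lapFst_sub hf hg)).trans ?_
  simp only [lapFst, integral_mul_sphLaplacian_sub (hf.slice_fst _) (hg.slice_fst _),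
    integral_zero]

theorem integral_mul_lapSnd_sub (hf : SmoothM p q f) (hg : SmoothM p q g) :
    ∫ z, (f z * lapSnd g z - lapSnd f z * g z) ∂vol p q = 0 := by
  refine (integral_prod _ (integrable_mul_lapSnd_sub hf hg)).trans ?_
  simp only [lapSnd, integral_mul_sphLaplacian_sub (hf.slice_snd _) (hg.slice_snd _),
    integral_zero]

theorem integral_mul_yamabe_sub (hf : SmoothM p q f) (hg : SmoothM p q g) :
    ∫ z, (f z * yamabe g z - yamabe f z * g z) ∂vol p q = 0 := by
  have h_sub (z : M p q) : f z * yamabe g z - yamabe f z * g z =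
      (f z * lapFst g z - lapFst f z * g z) - (f z * lapSnd g z - lapSnd f z * g z) := by
    simp only [yamabe]
    ring
  simp only [h_sub]
  rw [integral_sub (integrable_mul_lapFst_sub hf hg) (integrable_mul_lapSnd_sub hf hg),
    integral_mul_lapFst_sub hf hg, integral_mul_lapSnd_sub hf hg, sub_zero]

end Green

section Tensor

variable {p q a b : ℕ} {Y : C(Sph p, ℂ)} {Z : C(Sph q, ℂ)}

theorem smoothM_tensorHom [NeZero p] [NeZero q] (hY : SmoothSph p Y) (hZ : SmoothSph q Z) :
    SmoothM p q (tensorHom p q Y Z) :=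
  (contDiff_mul (𝕜 := ℝ) (𝔸 := ℂ)).comp_contMDiff
    ((ContMDiff.comp hY contMDiff_fst).prodMk_space (ContMDiff.comp hZ contMDiff_snd))

theorem lapFst_tensorHom [NeZero p] (hY : Y ∈ harmonics p a) (Z : C(Sph q, ℂ)) (z : M p q) :
    lapFst (tensorHom p q Y Z) z = -(lapEigval p a : ℂ) * tensorHom p q Y Z z := by
  have h_slice : (fun x => tensorHom p q Y Z (x, z.2)) = Z z.2 • (Y : Sph p → ℂ) := by
    funext x
    simp [mul_comm]
  rw [lapFst, h_slice, sphLaplacian_smul _ hY.1, sphLaplacian_of_mem_harmonics hY, tensorHom_apply]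
  ring

theorem lapSnd_tensorHom [NeZero q] (Y : C(Sph p, ℂ)) (hZ : Z ∈ harmonics q b) (z : M p q) :
    lapSnd (tensorHom p q Y Z) z = -(lapEigval q b : ℂ) * tensorHom p q Y Z z := by
  have h_slice : (fun y => tensorHom p q Y Z (z.1, y)) = Y z.1 • (Z : Sph q → ℂ) := by
    funext y
    simp
  rw [lapSnd, h_slice, sphLaplacian_smul _ hZ.1, sphLaplacian_of_mem_harmonics hZ, tensorHom_apply]
  ring

theorem yamabe_tensorHom [Fact (2 ≤ p)] [Fact (2 ≤ q)] (hY : Y ∈ harmonics p a)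
    (hZ : Z ∈ harmonics q b) (z : M p q) :
    yamabe (tensorHom p q Y Z) z
      = ((eigval q b ^ 2 - eigval p a ^ 2 : ℝ) : ℂ) * tensorHom p q Y Z z := by
  have hp : (2 : ℝ) ≤ p := by exact_mod_cast (Fact.out : 2 ≤ p)
  have hq : (2 : ℝ) ≤ q := by exact_mod_cast (Fact.out : 2 ≤ q)
  have h_ne : (p : ℝ) + q - 2 - 1 ≠ 0 := by linarith
  have h_eigval : -lapEigval p a + lapEigval q b
      - (((p : ℝ) + q - 2) - 2) / (4 * (((p : ℝ) + q - 2) - 1)) * scalarCurvature p q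
        = eigval q b ^ 2 - eigval p a ^ 2 := by
    unfold lapEigval scalarCurvature eigval
    field_simp
    ring
  rw [← h_eigval, yamabe, lapFst_tensorHom hY, lapSnd_tensorHom _ hZ]
  push_cast
  ring

end Tensor

section Star

variable {p q : ℕ} [NeZero p] [NeZero q] {f : M p q → ℂ}

theorem SmoothM.star (hf : SmoothM p q f) : SmoothM p q (star f) :=
  Complex.conjCLE.toContinuousLinearMap.contDiff.comp_contMDiff hf

theorem yamabe_star (hf : SmoothM p q f) (z : M p q) :
    yamabe (star f) z = star (yamabe f z) := by
  have h_fst := sphLaplacian_star (hf.slice_fst z.2) z.1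
  have h_snd := sphLaplacian_star (hf.slice_snd z.1) z.2
  change sphLaplacian (star fun x => f (x, z.2)) z.1 - sphLaplacian (star fun y => f (z.1, y)) z.2
    - _ * star (f z) = _
  rw [h_fst, h_snd]
  simp [yamabe, lapFst, lapSnd]

end Star

/-! ## The operators on the `K`-types -/

section Components

variable {p q : ℕ}

theorem eigval_eq_iff {a b : ℕ} : eigval p a = eigval q b ↔ 2 * a + p = 2 * b + q := by
  rw [← Nat.cast_inj (R := ℝ), eigval, eigval]
  push_cast
  constructor <;> intro h <;> linarith

theorem integral_toL2_mul (f : C(M p q, ℂ)) (g : M p q → ℂ) :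
    ∫ z, toL2 p q f z * g z ∂vol p q = ∫ z, f z * g z ∂vol p q := by
  refine integral_congr_ae ?_
  filter_upwards [toL2_coeFn f] with z hz
  rw [hz]

/-- The set of indices `(a, b)` with `a + p / 2 = b + q / 2`, written without division. They are
the indices of the `K`-types on which the Yamabe operator vanishes. -/
def diagIndex (p q : ℕ) : Set (ℕ × ℕ) := {k | 2 * k.1 + p = 2 * k.2 + q}

theorem hasSum_diagIndex {E : Type*} [AddCommMonoid E] [TopologicalSpace E] {u : ℕ × ℕ → E} {x : E}
    (hu : HasSum u x) (h_zero : ∀ k ∉ diagIndex p q, u k = 0) :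
    HasSum (fun k : diagIndex p q => u k) x :=
  (hasSum_subtype_iff_of_support_subset fun _ hk => not_imp_comm.1 (h_zero _) hk).2 hu

/-- The Hilbert sum in `L²(M)` of the `K`-types indexed by `diagIndex p q`. -/
def diagSpace (p q : ℕ) [NeZero p] [NeZero q] : Set (L2M p q) :=
  {F | ∀ k ∉ diagIndex p q, kComp k.1 k.2 F = 0}

variable [Fact (2 ≤ p)] [Fact (2 ≤ q)]

theorem eigval_nonneg (a : ℕ) : 0 ≤ eigval p a := by
  have hp : (2 : ℝ) ≤ p := by exact_mod_cast (Fact.out : 2 ≤ p)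
  unfold eigval
  linarith [a.cast_nonneg (α := ℝ)]

theorem eigval_sq_sub_eq_zero_iff {k : ℕ × ℕ} :
    ((eigval q k.2 ^ 2 - eigval p k.1 ^ 2 : ℝ) : ℂ) = 0 ↔ k ∈ diagIndex p q := by
  rw [Complex.ofReal_eq_zero, sub_eq_zero, sq_eq_sq₀ (eigval_nonneg _) (eigval_nonneg _), eq_comm]
  exact eigval_eq_iff

theorem kComp_toL2_eq_smul {a b : ℕ} {f g : C(M p q, ℂ)} {c : ℂ}
    (h : ∀ Y ∈ harmonics p a, ∀ Z ∈ harmonics q b,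
      ∫ z, (f z * (c * tensorHom p q Y Z z) - g z * tensorHom p q Y Z z) ∂vol p q = 0) :
    kComp a b (toL2 p q g) = c • kComp a b (toL2 p q f) := by
  refine kComp_eq_smul_of_integral_eq fun Y hY Z hZ => ?_
  have h_int := h Y hY Z hZ
  rw [integral_sub (integrable_vol (by fun_prop)) (integrable_vol (by fun_prop)),
    sub_eq_zero] at h_int
  simp only [mul_left_comm _ c, integral_const_mul] at h_int
  rw [integral_toL2_mul, integral_toL2_mul, h_int]

theorem kComp_lapFst {f : C(M p q, ℂ)} (hf : SmoothM p q f) (a b : ℕ) :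
    kComp a b (toL2 p q ⟨lapFst f, hf.continuous_lapFst⟩)
      = -(lapEigval p a : ℂ) • kComp a b (toL2 p q f) :=
  kComp_toL2_eq_smul fun _ hY _ hZ => by
    simpa only [lapFst_tensorHom hY, ContinuousMap.coe_mk] using
      integral_mul_lapFst_sub hf (smoothM_tensorHom hY.1 hZ.1)

theorem kComp_yamabe {f : C(M p q, ℂ)} (hf : SmoothM p q f) (a b : ℕ) :
    kComp a b (toL2 p q ⟨yamabe f, hf.continuous_yamabe⟩)
      = ((eigval q b ^ 2 - eigval p a ^ 2 : ℝ) : ℂ) • kComp a b (toL2 p q f) :=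
  kComp_toL2_eq_smul fun _ hY _ hZ => by
    simpa only [yamabe_tensorHom hY hZ, ContinuousMap.coe_mk] using
      integral_mul_yamabe_sub hf (smoothM_tensorHom hY.1 hZ.1)

theorem toL2_mem_domDp {f : C(M p q, ℂ)} (hf : SmoothM p q f) : toL2 p q f ∈ domDp p q := by
  have hp : (2 : ℝ) ≤ p := by exact_mod_cast (Fact.out : 2 ≤ p)
  have h_lap := (IsInternalHilbertSum.starProjection_eq_smul_iff_of_le (π := Prod.fst)
    (c := fun a => -(lapEigval p a : ℂ)) (isInternalHilbertSum_kType p q)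
    (isInternalHilbertSum_compFst p q) (kType_le_compFst p q)).2 fun k => kComp_lapFst hf k.1 k.2
  have h_sum_lap := ((isInternalHilbertSum_compFst p q).hasSum_norm_sq_starProjection
    (toL2 p q ⟨lapFst f, hf.continuous_lapFst⟩)).summable
  have h_sum := ((isInternalHilbertSum_compFst p q).hasSum_norm_sq_starProjection
    (toL2 p q f)).summable
  simp only [h_lap, norm_smul, mul_pow, norm_neg, Complex.norm_real, Real.norm_eq_abs,
    sq_abs] at h_sum_lap
  have h_le (a : ℕ) : eigval p a ≤ (p - 2) / 2 + lapEigval p a ^ 2 := by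
    obtain rfl | ha := Nat.eq_zero_or_pos a
    · simp [eigval, lapEigval]
    · have ha : (1 : ℝ) ≤ a := by exact_mod_cast ha
      have h_lapEigval : (a : ℝ) ≤ lapEigval p a := by unfold lapEigval; nlinarith
      unfold eigval
      nlinarith
  refine .of_nonneg_of_le (fun a => mul_nonneg (eigval_nonneg a) (sq_nonneg _)) (fun a => ?_)
    ((h_sum.mul_left (((p : ℝ) - 2) / 2)).add h_sum_lap)
  rw [← add_mul]
  exact mul_le_mul_of_nonneg_right (h_le a) (sq_nonneg _)

theorem toL2_mem_diagSpace {f : C(M p q, ℂ)} (hf : f ∈ V p q) : toL2 p q f ∈ diagSpace p q := by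
  intro k hk
  have h_yamabe : (⟨yamabe f, hf.1.continuous_yamabe⟩ : C(M p q, ℂ)) = 0 :=
    ContinuousMap.ext hf.2
  have h_smul := kComp_yamabe hf.1 k.1 k.2
  rw [h_yamabe, map_zero, kComp, map_zero] at h_smul
  exact (smul_eq_zero.1 h_smul.symm).resolve_left (mt eigval_sq_sub_eq_zero_iff.1 hk)

theorem WeakYamabeZero.mem_diagSpace {F : L2M p q} (hF : WeakYamabeZero F) :
    F ∈ diagSpace p q := by
  intro k hk
  rw [← zero_smul ℂ (kComp k.1 k.2 F)]
  refine kComp_eq_smul_of_integral_eq fun Y hY Z hZ => ?_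
  have h_int := hF _ (smoothM_tensorHom hY.1 hZ.1)
  simp only [yamabe_tensorHom hY hZ, mul_left_comm, integral_const_mul] at h_int
  rw [zero_mul]
  exact (mul_eq_zero.1 h_int).resolve_left (mt eigval_sq_sub_eq_zero_iff.1 hk)

theorem weakYamabeZero_of_mem_diagSpace {F : L2M p q} (hF : F ∈ diagSpace p q) :
    WeakYamabeZero F := by
  intro φ hφ
  let ψ : C(M p q, ℂ) := ⟨star φ, hφ.star.continuous⟩
  have hψ : SmoothM p q ψ := hφ.star
  let N := toL2 p q ⟨yamabe ψ, hψ.continuous_yamabe⟩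
  have h_inner : inner ℂ N F = ∫ z, F z * yamabe φ z ∂vol p q := by
    refine (inner_toL2 _ F).trans (integral_congr_ae (.of_forall fun z => ?_))
    change F z * star (yamabe (star φ) z) = _
    rw [yamabe_star hφ, star_star]
  have h_zero (k : ℕ × ℕ) : inner ℂ N (kComp k.1 k.2 F) = 0 := by
    by_cases hk : k ∈ diagIndex p q
    · have hN : kComp k.1 k.2 N = 0 :=
        (kComp_yamabe hψ k.1 k.2).trans (by rw [eigval_sq_sub_eq_zero_iff.2 hk, zero_smul])
      rw [kComp, ← Submodule.inner_starProjection_left_eq_right, ← kComp, hN, inner_zero_left]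
    · rw [hF k hk, inner_zero_right]
  have h_sum := ((isInternalHilbertSum_kType p q).hasSum_starProjection F).mapL (innerSL ℂ N)
  rw [← h_inner]
  exact (h_sum.congr_fun fun k => (h_zero k).symm).unique hasSum_zero

theorem weakYamabeZero_iff_mem_diagSpace {F : L2M p q} :
    WeakYamabeZero F ↔ F ∈ diagSpace p q :=
  ⟨WeakYamabeZero.mem_diagSpace, weakYamabeZero_of_mem_diagSpace⟩

end Components

section Domains

theorem norm_sq_sqrt_smul {E : Type*} [NormedAddCommGroup E] [NormedSpace ℂ E] {r : ℝ} (hr : 0 ≤ r)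
    (x : E) : ‖((Real.sqrt r : ℝ) : ℂ) • x‖ ^ 2 = r * ‖x‖ ^ 2 := by
  rw [norm_smul, mul_pow, Complex.norm_real, Real.norm_eq_abs, sq_abs, Real.sq_sqrt hr]

variable {p q : ℕ} [Fact (2 ≤ p)] [Fact (2 ≤ q)] {F G : L2M p q}

theorem mem_domDp_and_Dp_eq_iff : F ∈ domDp p q ∧ Dp F = G ↔
    ∀ k : ℕ × ℕ, kComp k.1 k.2 G = ((Real.sqrt (eigval p k.1) : ℝ) : ℂ) • kComp k.1 k.2 F := by
  refine Iff.trans ?_ (IsInternalHilbertSum.starProjection_eq_smul_iff_of_le (π := Prod.fst)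
    (c := fun a => ((Real.sqrt (eigval p a) : ℝ) : ℂ)) (isInternalHilbertSum_kType p q)
    (isInternalHilbertSum_compFst p q) (kType_le_compFst p q))
  rw [← (isInternalHilbertSum_compFst p q).summable_and_tsum_smul_eq_iff]
  simp only [norm_sq_sqrt_smul (eigval_nonneg _)]
  rfl

theorem mem_domDq_and_Dq_eq_iff : F ∈ domDq p q ∧ Dq F = G ↔
    ∀ k : ℕ × ℕ, kComp k.1 k.2 G = ((Real.sqrt (eigval q k.2) : ℝ) : ℂ) • kComp k.1 k.2 F := by
  refine Iff.trans ?_ (IsInternalHilbertSum.starProjection_eq_smul_iff_of_le (π := Prod.snd)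
    (c := fun b => ((Real.sqrt (eigval q b) : ℝ) : ℂ)) (isInternalHilbertSum_kType p q)
    (isInternalHilbertSum_compSnd p q) (kType_le_compSnd p q))
  rw [← (isInternalHilbertSum_compSnd p q).summable_and_tsum_smul_eq_iff]
  simp only [norm_sq_sqrt_smul (eigval_nonneg _)]
  rfl

theorem kComp_Dp (hF : F ∈ domDp p q) (k : ℕ × ℕ) :
    kComp k.1 k.2 (Dp F) = ((Real.sqrt (eigval p k.1) : ℝ) : ℂ) • kComp k.1 k.2 F :=
  mem_domDp_and_Dp_eq_iff.1 ⟨hF, rfl⟩ k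

theorem mem_domDq_and_Dq_eq_Dp_iff (hF : F ∈ domDp p q) :
    F ∈ domDq p q ∧ Dq F = Dp F ↔ F ∈ diagSpace p q := by
  rw [mem_domDq_and_Dq_eq_iff]
  refine forall_congr' fun k => ?_
  rw [kComp_Dp hF, ← sub_eq_zero, ← sub_smul, smul_eq_zero, ← Complex.ofReal_sub,
    Complex.ofReal_eq_zero, sub_eq_zero, Real.sqrt_inj (eigval_nonneg _) (eigval_nonneg _),
    eigval_eq_iff, or_iff_not_imp_left]
  rfl

theorem setOf_Dp_eq_Dq (p q : ℕ) [Fact (2 ≤ p)] [Fact (2 ≤ q)] :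
    {F | F ∈ domDp p q ∩ domDq p q ∧ Dp F = Dq F} = domDp p q ∩ diagSpace p q := by
  ext F
  rw [Set.mem_ofPred_eq, Set.mem_inter_iff, Set.mem_inter_iff, and_assoc, eq_comm]
  exact and_congr_right mem_domDq_and_Dq_eq_Dp_iff

theorem setOf_weakYamabeZero (p q : ℕ) [Fact (2 ≤ p)] [Fact (2 ≤ q)] :
    {F | F ∈ domDp p q ∩ domDq p q ∧ WeakYamabeZero F} = domDp p q ∩ diagSpace p q := by
  ext F
  rw [Set.mem_ofPred_eq, weakYamabeZero_iff_mem_diagSpace]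
  exact ⟨fun h => ⟨h.1.1, h.2⟩, fun h => ⟨⟨h.1, ((mem_domDq_and_Dq_eq_Dp_iff h.1).2 h.2).1⟩, h.2⟩⟩

theorem norm_sq_Dp (hF : F ∈ domDp p q ∩ diagSpace p q) :
    ‖Dp F‖ ^ 2 = 1 / 4 * ‖Dp F + Dq F‖ ^ 2 := by
  rw [((mem_domDq_and_Dq_eq_Dp_iff hF.1).2 hF.2).2, ← two_smul ℂ, norm_smul, Complex.norm_ofNat]
  ring

theorem hasSum_kComp (hF : F ∈ diagSpace p q) :
    HasSum (fun k : diagIndex p q => kComp k.1.1 k.1.2 F) F :=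
  hasSum_diagIndex (u := fun k => kComp k.1 k.2 F)
    ((isInternalHilbertSum_kType p q).hasSum_starProjection F) hF

theorem hasSum_sqrt_eigval_smul_kComp (hF : F ∈ domDp p q ∩ diagSpace p q) :
    HasSum (fun k : diagIndex p q =>
      ((Real.sqrt (eigval p k.1.1) : ℝ) : ℂ) • kComp k.1.1 k.1.2 F) (Dp F) := by
  simp only [← kComp_Dp hF.1]
  exact hasSum_kComp fun k hk => by rw [kComp_Dp hF.1, hF.2 k hk, smul_zero]

theorem hasSum_eigval_mul_norm_sq_kComp (hF : F ∈ domDp p q ∩ diagSpace p q) :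
    HasSum (fun k : diagIndex p q => eigval p k.1.1 * ‖kComp k.1.1 k.1.2 F‖ ^ 2)
      (‖Dp F‖ ^ 2) := by
  refine hasSum_diagIndex (u := fun k => eigval p k.1 * ‖kComp k.1 k.2 F‖ ^ 2) ?_
    fun k hk => by rw [hF.2 k hk, norm_zero, zero_pow two_ne_zero, mul_zero]
  simp only [← norm_sq_sqrt_smul (eigval_nonneg _), ← kComp_Dp hF.1]
  exact (isInternalHilbertSum_kType p q).hasSum_norm_sq_starProjection (Dp F)

end Domains

/-! ## The Hilbert completion of `V^{p,q}` -/

section Completion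

variable (p q : ℕ) [Fact (2 ≤ p)] [Fact (2 ≤ q)]

/-- The inclusion `V^{p,q} ⊂ L²(M)`. -/
def inclV : V p q →ₗ[ℂ] L2M p q :=
  (toL2 p q).toLinearMap ∘ₗ (V p q).subtype

variable {p q}

theorem inclV_mem (f : V p q) : inclV p q f ∈ domDp p q ∩ diagSpace p q :=
  ⟨toL2_mem_domDp f.2.1, toL2_mem_diagSpace f.2⟩

variable (p q) in
/-- The restriction of `D_p` to `V^{p,q}`. -/
def DpV : V p q →ₗ[ℂ] L2M p q where
  toFun f := Dp (inclV p q f)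
  map_add' f g := (mem_domDp_and_Dp_eq_iff.2 fun k => by
    rw [map_add, kComp, kComp, map_add, map_add, smul_add]
    exact congrArg₂ (· + ·) (kComp_Dp (inclV_mem f).1 k) (kComp_Dp (inclV_mem g).1 k)).2
  map_smul' c f := (mem_domDp_and_Dp_eq_iff.2 fun k => by
    rw [map_smul, kComp, kComp, map_smul, map_smul, smul_comm]
    exact congrArg (c • ·) (kComp_Dp (inclV_mem f).1 k)).2

theorem starProjection_DpV (f : V p q) (k : ℕ × ℕ) :
    (kType p q k.1 k.2).starProjection (DpV p q f) =
      ((Real.sqrt (eigval p k.1) : ℝ) : ℂ) • (kType p q k.1 k.2).starProjection (inclV p q f) :=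
  kComp_Dp (inclV_mem f).1 k

theorem starProjection_inclV (f : V p q) (k : ℕ × ℕ) (hk : k ∉ diagIndex p q) :
    (kType p q k.1 k.2).starProjection (inclV p q f) = 0 :=
  (inclV_mem f).2 k hk

theorem unitaryForm_eq_inner (f g : V p q) :
    unitaryForm p q f g = inner ℂ (DpV p q g) (DpV p q f) :=
  (L2.inner_def (𝕜 := ℂ) (DpV p q g) (DpV p q f)).symm

variable (p q) in
theorem exists_isHilbertCompletion_unitaryForm :
    ∃ (H : Type) (_ : NormedAddCommGroup H) (_ : InnerProductSpace ℂ H) (ι : V p q →ₗ[ℂ] H),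
      IsHilbertCompletion (unitaryForm p q) ι :=
  exists_isHilbertCompletion (W := V p q) (D := DpV p q) unitaryForm_eq_inner

theorem half_le_eigval (hpq : (p, q) ≠ (2, 2)) {k : ℕ × ℕ} (hk : k ∈ diagIndex p q) :
    1 / 2 ≤ eigval p k.1 := by
  have hp : 2 ≤ p := Fact.out
  have hq : 2 ≤ q := Fact.out
  have h_diag : 2 * k.1 + p = 2 * k.2 + q := hk
  have h_three : 3 ≤ 2 * k.1 + p := by grind
  have h_three' : (3 : ℝ) ≤ 2 * k.1 + p := by exact_mod_cast h_three
  unfold eigval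
  linarith

theorem tensorHom_mem_V {k : ℕ × ℕ} (hk : k ∈ diagIndex p q) {Y : C(Sph p, ℂ)} {Z : C(Sph q, ℂ)}
    (hY : Y ∈ harmonics p k.1) (hZ : Z ∈ harmonics q k.2) : tensorHom p q Y Z ∈ V p q :=
  ⟨smoothM_tensorHom hY.1 hZ.1, fun z => by
    rw [yamabe_tensorHom hY hZ, eigval_sq_sub_eq_zero_iff.2 hk, zero_mul]⟩

theorem kType_le_topologicalClosure_range_inclV {k : ℕ × ℕ} (hk : k ∈ diagIndex p q) :
    kType p q k.1 k.2
      ≤ (LinearMap.range (inclV p q) ⊓ kType p q k.1 k.2).topologicalClosure := by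
  refine Submodule.topologicalClosure_mono (Submodule.span_le.2 ?_)
  rintro F ⟨Y, hY, Z, hZ, hF⟩
  obtain rfl : F = toL2 p q (tensorHom p q Y Z) :=
    Lp.ext (hF.trans (toL2_coeFn (tensorHom p q Y Z)).symm)
  exact ⟨⟨⟨_, tensorHom_mem_V hk hY hZ⟩, rfl⟩, toL2_tensorHom_mem_kType hY hZ⟩

theorem IsHilbertCompletion.exists_embedding (hpq : (p, q) ≠ (2, 2)) {H : Type*}
    [NormedAddCommGroup H] [InnerProductSpace ℂ H] {ι : V p q →ₗ[ℂ] H}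
    (hι : IsHilbertCompletion (unitaryForm p q) ι) :
    ∃ j : H →L[ℂ] L2M p q, (∀ f, j (ι f) = toL2 p q f) ∧ Function.Injective j ∧
      (∀ h, ‖h‖ = ‖Dp (j h)‖) ∧ Set.range j = domDp p q ∩ diagSpace p q := by
  have h_norm (k : ℕ × ℕ) (hk : k ∈ diagIndex p q) :
      √(1 / 2) ≤ ‖((Real.sqrt (eigval p k.1) : ℝ) : ℂ)‖ := by
    rw [Complex.norm_real, Real.norm_of_nonneg (Real.sqrt_nonneg _)]
    exact Real.sqrt_le_sqrt (half_le_eigval hpq hk)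
  obtain ⟨j, hj, hj_inj, hj_norm, hj_range⟩ := hι.exists_embedding_of_diagonal
    (K := fun k : ℕ × ℕ => kType p q k.1 k.2) (D := DpV p q) (τ := inclV p q)
    (S := diagIndex p q) (β := fun k => ((Real.sqrt (eigval p k.1) : ℝ) : ℂ))
    unitaryForm_eq_inner (isInternalHilbertSum_kType p q)
    -- At default transparency these unifications unfold `V p q` and time out.
    (by with_reducible_and_instances exact starProjection_DpV)
    (by with_reducible_and_instances exact starProjection_inclV)
    (by with_reducible_and_instances exact fun _ => kType_le_topologicalClosure_range_inclV)
    (Real.sqrt_pos.2 one_half_pos) h_norm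
  refine ⟨j, hj, hj_inj, fun h => ?_, hj_range.trans ?_⟩
  · obtain ⟨G, hG, h_eq⟩ := hj_norm h
    rw [← hG, (mem_domDp_and_Dp_eq_iff.2 h_eq).2]
  · ext F
    refine ⟨fun ⟨hF, G, hG⟩ => ⟨(mem_domDp_and_Dp_eq_iff.2 hG).1, hF⟩,
      fun ⟨hF_dom, hF⟩ => ⟨hF, Dp F, kComp_Dp hF_dom⟩⟩

end Completion

end MinRep

end

theorem theorem3p9 (p q : ℕ) [Fact (2 ≤ p)] [Fact (2 ≤ q)] (hpq : (p, q) ≠ (2, 2)) :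
    (∃ (H : Type) (_ : NormedAddCommGroup H) (_ : InnerProductSpace ℂ H)
        (ι : MinRep.V p q →ₗ[ℂ] H),
        MinRep.IsHilbertCompletion (MinRep.unitaryForm p q) ι) ∧
    ∀ {H : Type*} [NormedAddCommGroup H] [InnerProductSpace ℂ H]
      (ι : MinRep.V p q →ₗ[ℂ] H),
      MinRep.IsHilbertCompletion (MinRep.unitaryForm p q) ι →
      ∃ j : H →L[ℂ] MinRep.L2M p q,
        (∀ f : MinRep.V p q, j (ι f) = MinRep.toL2 p q f) ∧
        Function.Injective j ∧
        Set.range j =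
          {F | F ∈ MinRep.domDp p q ∩ MinRep.domDq p q ∧ MinRep.Dp F = MinRep.Dq F} ∧
        Set.range j =
          {F | F ∈ MinRep.domDp p q ∩ MinRep.domDq p q ∧ MinRep.WeakYamabeZero F} ∧
        ∀ h : H,
          ‖h‖ ^ 2 = 1 / 4 * ‖MinRep.Dp (j h) + MinRep.Dq (j h)‖ ^ 2 ∧
          HasSum (fun ab : {ab : ℕ × ℕ // 2 * ab.1 + p = 2 * ab.2 + q} =>
            MinRep.kComp ab.1.1 ab.1.2 (j h)) (j h) ∧
          HasSum (fun ab : {ab : ℕ × ℕ // 2 * ab.1 + p = 2 * ab.2 + q} =>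
            ((Real.sqrt ((ab.1.1 : ℝ) + ((p : ℝ) - 2) / 2) : ℝ) : ℂ) •
              MinRep.kComp ab.1.1 ab.1.2 (j h)) (MinRep.Dp (j h)) ∧
          HasSum (fun ab : {ab : ℕ × ℕ // 2 * ab.1 + p = 2 * ab.2 + q} =>
            ((ab.1.1 : ℝ) + ((p : ℝ) - 2) / 2) * ‖MinRep.kComp ab.1.1 ab.1.2 (j h)‖ ^ 2)
            (‖h‖ ^ 2) := by
  refine ⟨MinRep.exists_isHilbertCompletion_unitaryForm p q, fun {H} _ _ ι hι => ?_⟩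
  obtain ⟨j, hj, hj_inj, hj_norm, hj_range⟩ := hι.exists_embedding hpq
  refine ⟨j, hj, hj_inj, hj_range.trans (MinRep.setOf_Dp_eq_Dq p q).symm,
    hj_range.trans (MinRep.setOf_weakYamabeZero p q).symm, fun h => ?_⟩
  have hF : j h ∈ MinRep.domDp p q ∩ MinRep.diagSpace p q := hj_range ▸ Set.mem_range_self h
  rw [hj_norm h]
  exact ⟨MinRep.norm_sq_Dp hF, MinRep.hasSum_kComp hF.2,
    MinRep.hasSum_sqrt_eigval_smul_kComp hF, MinRep.hasSum_eigval_mul_norm_sq_kComp hF⟩
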